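/- All rings are commutative with one, graded means $\mathbb{Z}$-graded, and "homogeneous" ideals are those generated by homogeneous elements. A graded (or bigraded) ring $S$ is called *local if it has exactly one maximal element $\mathfrak m_S$ among its proper (bi)homogeneous ideals; its socle is then $\operatorname{soc} S=\operatorname{ann}_S\mathfrak m_S$. For an ideal $I$ of a ring $A$ let $\operatorname{gr}_I A=\bigoplus_{l\ge 0}I^l/I^{l+1}$, and let $\sigma_I\colon A\to\operatorname{gr}_I A$ be the symbol map: if $x\notin\bigcap_k I^k$ and $d=\max\{k\mid x\in I^k\}$, then $\sigma_I(x)$ is the class of $x$ in $I^d/I^{d+1}$; otherwise $\sigma_I(x)=0$. Let $R$ be a Noetherian *local graded ring and let $h=(h_1,\dots,h_t)$ be an $R$-sequence (a regular sequence in $R$) of homogeneous elements. Let $M$ be a $u\times t$ matrix with entries in $\mathbb{N}$ whose rows $m_1,\dots,m_u$ are nonzero. Put $R_h=R/\langle h\rangle$, $A=R/\langle h^M\rangle$ where $\langle h^M\rangle=\langle h^{m_1},\dots,h^{m_u}\rangle$, and let $\bar h$ be the image of $h$ in $A$. Let $G=\operatorname{gr}_{\langle\bar h\rangle}A$, bigraded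 by the degree $l$ of $\langle\bar h\rangle^l/\langle\bar h\rangle^{l+1}$ and the degree induced from $R$, and let $\sigma=\sigma_{\langle\bar h\rangle}$. Let $\mathbb{M}=\bigcup_i(m_i+\mathbb{N}^t)$ and $$\operatorname{soc}\mathbb{M}=\{n\in\mathbb{N}^t\setminus\mathbb{M}\mid n+(\mathbb{N}^t\setminus\{0\})\subset\mathbb{M}\}.$$ Then $R_h$, $A$ and $G$ are *local (for $G$, with respect to the bigrading), $\bigcap_k\langle\bar h\rangle^k=0$ in $A$, and the symbol map $\sigma\colon A\to G$ identifies the socles of $A$ and $G$ in the following sense. (a) For $m\in\operatorname{soc}\mathbb{M}$ the products $c\,\bar h^m\in A$ and $c\,\sigma(\bar h^m)\in G$ are well defined for $c\in R_h$. The $R$-linear maps $$\alpha\colon\bigoplus_{m\in\operatorname{soc}\mathbb{M}}R_h\to A,\ (c_m)\mapsto\sum_m c_m\bar h^m,\qquad \beta\colon\bigoplus_{m\in\operatorname{soc}\mathbb{M}}R_h\to G,\ (c_m)\mapsto\sum_m c_m\sigma(\bar h^m)$$ are injective, and they map $\bigoplus_{m\in\operatorname{soc}\mathbb{M}}\operatorname{soc}(R_h)$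 onto the socles: $$\operatorname{soc}A=\bigoplus_{m\in\operatorname{soc}\mathbb{M}}\operatorname{soc}(R_h)\,\bar h^m,\qquad \operatorname{soc}G=\bigoplus_{m\in\operatorname{soc}\mathbb{M}}\operatorname{soc}(R_h)\,\sigma(\bar h^m).$$ (b) If $c=(c_m)\in\bigoplus_{m\in\operatorname{soc}\mathbb{M}}R_h$ is nonzero and $d$ is the least value of $|m|=m^{(1)}+\dots+m^{(t)}$, the sum of the entries of $m=(m^{(1)},\dots,m^{(t)})$, over all $m$ with $c_m\ne0$, then $\sigma(\alpha(c))=\sum_{|m|=d}c_m\sigma(\bar h^m)$. The image of $\operatorname{soc}A$ under $\sigma$ is the set of all elements of $\operatorname{soc}G$ that lie in a single summand $\langle\bar h\rangle^l/\langle\bar h\rangle^{l+1}$ of $G$. (c) There is an $R$-linear isomorphism $\Phi\colon\operatorname{soc}A\to\operatorname{soc}G$ with $\Phi\bigl(\sum_m c_m\bar h^m\bigr)=\sum_m c_m\sigma(\bar h^m)$. It agrees with $\sigma$ on the elements $\sum_m c_m\bar h^m$ of $\operatorname{soc}A$ for which $|m|$ takes the same value on all $m$ with $c_m\neq0$. 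-/

import Mathlib

open scoped DirectSum

noncomputable section

/-! ### Graded ideals, \*local rings and socles -/

section StarLocal

variable {ι S : Type*} [CommRing S]

/-- An ideal `J` of a ring `S` with homogeneous pieces `𝒮 i` is homogeneous if it is generated by
the homogeneous elements that it contains. -/
def IsHomogeneousIdeal (𝒮 : ι → AddSubgroup S) (J : Ideal S) : Prop :=
  Ideal.span {x | x ∈ J ∧ ∃ i, x ∈ 𝒮 i} = J

/-- For a graded ring this is Mathlib's notion of a homogeneous ideal. -/
theorem isHomogeneousIdeal_iff [DecidableEq ι] [AddMonoid ι] (𝒮 : ι → AddSubgroup S)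
    [GradedRing 𝒮] (J : Ideal S) : IsHomogeneousIdeal 𝒮 J ↔ J.IsHomogeneous 𝒮 := by
  constructor
  · intro h
    rw [← show _ = J from h]
    exact Ideal.homogeneous_span 𝒮 _ fun x hx => hx.2
  · intro h
    refine le_antisymm (Ideal.span_le.2 fun x hx => hx.1) fun x hx => ?_
    classical
    rw [← DirectSum.sum_support_decompose 𝒮 x]
    exact Ideal.sum_mem _ fun i _ => Ideal.subset_span ⟨h i hx, i, SetLike.coe_mem _⟩

/-- A \*maximal ideal: maximal among the proper homogeneous ideals. -/
def IsStarMaximal (𝒮 : ι → AddSubgroup S) (𝔪 : Ideal S) : Prop :=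
  Maximal (fun J : Ideal S => IsHomogeneousIdeal 𝒮 J ∧ J ≠ ⊤) 𝔪

/-- A \*local ring: there is exactly one \*maximal ideal. For the pieces of a bigrading this says
that there is a unique bigraded maximal ideal. -/
def IsStarLocal (𝒮 : ι → AddSubgroup S) : Prop :=
  ∃! 𝔪 : Ideal S, IsStarMaximal 𝒮 𝔪

/-- The \*maximal ideal of a \*local ring (the supremum has only one member if `S` is \*local). -/
def starMaximalIdeal (𝒮 : ι → AddSubgroup S) : Ideal S :=
  sSup {𝔪 : Ideal S | IsStarMaximal 𝒮 𝔪}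

theorem IsStarMaximal.starMaximalIdeal_eq {𝒮 : ι → AddSubgroup S} (h : IsStarLocal 𝒮)
    {𝔪 : Ideal S} (hm : IsStarMaximal 𝒮 𝔪) : starMaximalIdeal 𝒮 = 𝔪 := by
  have : {𝔪 : Ideal S | IsStarMaximal 𝒮 𝔪} = {𝔪} :=
    Set.ext fun J => ⟨fun hJ => h.unique hJ hm, fun hJ => by rw [Set.mem_singleton_iff.1 hJ]; exact hm⟩
  rw [starMaximalIdeal, this, sSup_singleton]

/-- The (homogeneous) socle: the annihilator of the \*maximal ideal. -/
def starSocle (𝒮 : ι → AddSubgroup S) : Ideal S :=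
  (starMaximalIdeal 𝒮).annihilator

/-- The grading on a quotient ring `S ⧸ J`: its pieces are the images of the pieces of `S`. -/
def quotientGrading (𝒮 : ι → AddSubgroup S) (J : Ideal S) : ι → AddSubgroup (S ⧸ J) :=
  fun i => (𝒮 i).map (Ideal.Quotient.mk J : S →+ S ⧸ J)

end StarLocal

/-! ### The associated graded ring `gr_I A = ⨁ l, I ^ l / I ^ (l + 1)` -/

namespace Ideal

variable {A : Type*} [CommRing A] (I : Ideal A)

/-- The piece `I ^ l / I ^ (l + 1)`. -/
abbrev GrPiece (l : ℕ) : Type _ :=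
  ↥(I ^ l) ⧸ Submodule.comap (I ^ l).subtype (I ^ (l + 1))

/-- The class in `I ^ l / I ^ (l + 1)` of an element of `I ^ l`. -/
abbrev grMk (l : ℕ) (x : ↥(I ^ l)) : I.GrPiece l := Submodule.Quotient.mk x

variable {I} in
theorem grMk_eq_iff {l : ℕ} {x y : ↥(I ^ l)} :
    I.grMk l x = I.grMk l y ↔ (x : A) - y ∈ I ^ (l + 1) :=
  Submodule.Quotient.eq _

/-- The product `I ^ i / I ^ (i + 1) × I ^ j / I ^ (j + 1) → I ^ (i + j) / I ^ (i + j + 1)` induced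
by the multiplication of `A`. -/
def grMul (i j : ℕ) (a : I.GrPiece i) (b : I.GrPiece j) : I.GrPiece (i + j) :=
  Quotient.liftOn₂ a b
    (fun x y => I.grMk (i + j) ⟨(x : A) * y, by rw [pow_add]; exact mul_mem_mul x.2 y.2⟩) <| by
    intro x y x' y' hx hy
    have hx : (x : A) - x' ∈ I ^ (i + 1) := grMk_eq_iff.1 (Quotient.sound hx)
    have hy : (y : A) - y' ∈ I ^ (j + 1) := grMk_eq_iff.1 (Quotient.sound hy)
    refine grMk_eq_iff.2 ?_
    have h1 : ((x : A) - x') * y ∈ I ^ (i + j + 1) := by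
      rw [show i + j + 1 = i + 1 + j by ring, pow_add]; exact mul_mem_mul hx y.2
    have h2 : (x' : A) * (y - y') ∈ I ^ (i + j + 1) := by
      rw [show i + j + 1 = i + (j + 1) by ring, pow_add]; exact mul_mem_mul x'.2 hy
    have := add_mem h1 h2
    simpa [sub_mul, mul_sub] using this

theorem gr_mk_eq {i j : ℕ} (hij : i = j) (x : ↥(I ^ i)) (y : ↥(I ^ j)) (h : (x : A) = y) :
    (GradedMonoid.mk i (I.grMk i x) : GradedMonoid I.GrPiece) = GradedMonoid.mk j (I.grMk j y) := by
  subst hij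
  rw [Subtype.ext h]

instance grGMul : GradedMonoid.GMul I.GrPiece where
  mul {i j} a b := I.grMul i j a b

instance grGOne : GradedMonoid.GOne I.GrPiece where
  one := I.grMk 0 ⟨1, by simp⟩

instance grGCommRing : DirectSum.GCommRing I.GrPiece where
  mul_zero {i j} a := by
    induction a using Submodule.Quotient.induction_on with | _ x =>
    exact grMk_eq_iff.2 (by simp)
  zero_mul {i j} b := by
    induction b using Submodule.Quotient.induction_on with | _ x =>
    exact grMk_eq_iff.2 (by simp)
  mul_add {i j} a b c := by
    induction a using Submodule.Quotient.induction_on with | _ x =>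
    induction b using Submodule.Quotient.induction_on with | _ y =>
    induction c using Submodule.Quotient.induction_on with | _ z =>
    exact grMk_eq_iff.2 (by simp [mul_add])
  add_mul {i j} a b c := by
    induction a using Submodule.Quotient.induction_on with | _ x =>
    induction b using Submodule.Quotient.induction_on with | _ y =>
    induction c using Submodule.Quotient.induction_on with | _ z =>
    exact grMk_eq_iff.2 (by simp [add_mul])
  one_mul := by
    rintro ⟨i, a⟩
    induction a using Submodule.Quotient.induction_on with | _ x =>
    exact I.gr_mk_eq (zero_add i) _ _ (one_mul _)
  mul_one := by
    rintro ⟨i, a⟩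
    induction a using Submodule.Quotient.induction_on with | _ x =>
    exact I.gr_mk_eq (add_zero i) _ _ (mul_one _)
  mul_assoc := by
    rintro ⟨i, a⟩ ⟨j, b⟩ ⟨k, c⟩
    induction a using Submodule.Quotient.induction_on with | _ x =>
    induction b using Submodule.Quotient.induction_on with | _ y =>
    induction c using Submodule.Quotient.induction_on with | _ z =>
    exact I.gr_mk_eq (add_assoc i j k) _ _ (mul_assoc _ _ _)
  mul_comm := by
    rintro ⟨i, a⟩ ⟨j, b⟩
    induction a using Submodule.Quotient.induction_on with | _ x =>
    induction b using Submodule.Quotient.induction_on with | _ y =>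
    exact I.gr_mk_eq (add_comm i j) _ _ (mul_comm _ _)
  natCast n := I.grMk 0 ⟨n, by simp⟩
  natCast_zero := grMk_eq_iff.2 (by simp)
  natCast_succ n := grMk_eq_iff.2 (by simp)
  intCast n := I.grMk 0 ⟨n, by simp⟩
  intCast_ofNat n := grMk_eq_iff.2 (by simp)
  intCast_negSucc_ofNat n := grMk_eq_iff.2 (by simp)

instance grGAlgebra {R : Type*} [CommRing R] [Algebra R A] : DirectSum.GAlgebra R I.GrPiece where
  toFun :=
    { toFun := fun r => I.grMk 0 ⟨algebraMap R A r, by simp⟩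
      map_zero' := grMk_eq_iff.2 (by simp)
      map_add' := fun r s => grMk_eq_iff.2 (by simp) }
  map_one := grMk_eq_iff.2 (by simp)
  map_mul r s := I.gr_mk_eq rfl _ _ (map_mul _ r s)
  commutes := by
    rintro r ⟨i, a⟩
    induction a using Submodule.Quotient.induction_on with | _ x =>
    exact I.gr_mk_eq ((zero_add i).trans (add_zero i).symm) _ _ (mul_comm _ _)
  smul_def := by
    rintro r ⟨i, a⟩
    induction a using Submodule.Quotient.induction_on with | _ x =>
    exact I.gr_mk_eq (zero_add i).symm _ _ (Algebra.smul_def r (x : A))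

/-- The associated `I`-graded ring `gr_I A = ⨁ l, I ^ l / I ^ (l + 1)`. -/
def Gr : Type _ := ⨁ l, I.GrPiece l

instance grCommRing : CommRing I.Gr := inferInstanceAs (CommRing (⨁ l, I.GrPiece l))

/-- If `A` is an `R`-algebra, then so is `gr_I A`, through `R → A → A / I`. -/
instance grAlgebra {R : Type*} [CommRing R] [Algebra R A] : Algebra R I.Gr :=
  inferInstanceAs (Algebra R (⨁ l, I.GrPiece l))

/-- The inclusion of the piece of degree `l` into `gr_I A`. -/
def grOf (l : ℕ) : I.GrPiece l →+ I.Gr := DirectSum.of I.GrPiece l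

/-- If `A` is graded with pieces `𝒜 d`, then `gr_I A` carries the bigrading whose piece of bidegree
`(l, d)` consists of the classes in `I ^ l / I ^ (l + 1)` of the elements of `I ^ l ∩ 𝒜 d`. -/
def grBigrading {ι : Type*} (𝒜 : ι → AddSubgroup A) : ℕ × ι → AddSubgroup I.Gr :=
  fun p => (((𝒜 p.2).comap (I ^ p.1).subtype.toAddMonoidHom).map
    (Submodule.mkQ (Submodule.comap (I ^ p.1).subtype (I ^ (p.1 + 1)))).toAddMonoidHom).map
      (I.grOf p.1)

open Classical in
/-- The `I`-order of an element outside `⋂ k, I ^ k`. -/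
def ordNat (x : A) (hx : ∃ k, x ∉ I ^ (k + 1)) : ℕ := Nat.find hx

/-- The order is the largest `k` with `x ∈ I ^ k`. -/
theorem isGreatest_ordNat (x : A) (hx : ∃ k, x ∉ I ^ (k + 1)) :
    IsGreatest {k | x ∈ I ^ k} (I.ordNat x hx) := by
  classical
  have hmem : x ∈ I ^ (I.ordNat x hx) := by
    rcases hn : I.ordNat x hx with _ | n
    · simp
    · have : n < Nat.find hx := by
        have : Nat.find hx = n + 1 := by rw [← hn]; unfold ordNat; congr
        omega
      exact not_not.1 (Nat.find_min hx this)
  refine ⟨hmem, fun k hk => ?_⟩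
  by_contra hlt
  have h1 : x ∉ I ^ (I.ordNat x hx + 1) := Nat.find_spec hx
  exact h1 (Ideal.pow_le_pow_right (by omega) hk)

open Classical in
/-- The `I`-symbol map, extended by zero: an element `x` outside `⋂ k, I ^ k`, of order `d`, is sent
to its class in `I ^ d / I ^ (d + 1)`; the elements of `⋂ k, I ^ k` are sent to zero. -/
def symbol (x : A) : I.Gr :=
  if hx : ∃ k, x ∉ I ^ (k + 1) then
    I.grOf (I.ordNat x hx)
      (I.grMk (I.ordNat x hx) ⟨x, (I.isGreatest_ordNat x hx).1⟩)
  else 0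

theorem smul_gr_eq_zero {R : Type*} [CommRing R] [Algebra R A] {r : R} (hr : algebraMap R A r ∈ I)
    (y : I.Gr) : r • y = 0 := by
  change ⨁ l, I.GrPiece l at y
  change (r • y : ⨁ l, I.GrPiece l) = 0
  induction y using DirectSum.induction_on with
  | zero => simp
  | add y z hy hz => rw [smul_add, hy, hz, add_zero]
  | of l c =>
    induction c using Submodule.Quotient.induction_on with | _ x =>
    rw [← DirectSum.of_smul]
    have : r • I.grMk l x = I.grMk l 0 :=
      grMk_eq_iff.2 (by
        simpa [pow_succ', Algebra.smul_def] using mul_mem_mul hr x.2)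
    rw [show r • (Submodule.Quotient.mk x : I.GrPiece l) = 0 from this, map_zero]

end Ideal

/-! ### Monoid ideals and monomial ideals -/

section Monomial

variable {u t : ℕ}

/-- The monoid ideal of `ℕ ^ t` generated by the rows of `M`. -/
def monoidIdeal (M : Matrix (Fin u) (Fin t) ℕ) : Set (Fin t → ℕ) :=
  {n | ∃ i, ∃ k : Fin t → ℕ, n = M i + k}

/-- The socle of a monoid ideal `𝕄` of `ℕ ^ t`. -/
def monoidSocle (𝕄 : Set (Fin t → ℕ)) : Set (Fin t → ℕ) :=
  {n | n ∉ 𝕄 ∧ ∀ k : Fin t → ℕ, k ≠ 0 → n + k ∈ 𝕄}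

variable {R : Type*} [CommRing R] (h : Fin t → R) (M : Matrix (Fin u) (Fin t) ℕ)

/-- The monomial `h ^ m`. -/
def monomialPow (m : Fin t → ℕ) : R := ∏ j, h j ^ m j

/-- The ideal `⟨h⟩` generated by the components of `h`. -/
abbrev seqIdeal : Ideal R := Ideal.span (Set.range h)

/-- The monomial ideal `⟨h ^ M⟩` generated by the monomials `h ^ m`, for `m` a row of `M`. -/
abbrev monomialIdeal : Ideal R := Ideal.span (Set.range fun i => monomialPow h (M i))

/-- The ideal `⟨h̄⟩` of `R ⧸ ⟨h ^ M⟩` generated by the residue classes of the components of `h`. -/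
abbrev residueIdeal : Ideal (R ⧸ monomialIdeal h M) :=
  Ideal.span (Set.range fun j => Ideal.Quotient.mk (monomialIdeal h M) (h j))

theorem monomialPow_add (m k : Fin t → ℕ) :
    monomialPow h (m + k) = monomialPow h m * monomialPow h k := by
  simp [monomialPow, pow_add, Finset.prod_mul_distrib]

theorem monomialPow_single (j : Fin t) : monomialPow h (Pi.single j 1) = h j := by
  rw [monomialPow, Finset.prod_eq_single j]
  · simp
  · intro i _ hij; simp [Pi.single_eq_of_ne hij]
  · simp

theorem mul_monomialPow_mem {m : Fin t → ℕ} (hm : m ∈ monoidSocle (monoidIdeal M)) {a : R}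
    (ha : a ∈ seqIdeal h) : a * monomialPow h m ∈ monomialIdeal h M := by
  induction ha using Submodule.span_induction with
  | mem x hx =>
    obtain ⟨j, rfl⟩ := hx
    obtain ⟨i, k, hik⟩ := hm.2 (Pi.single j 1) (by simp)
    rw [mul_comm]
    change monomialPow h m * h j ∈ _
    rw [← monomialPow_single h j]
    rw [← monomialPow_add, hik, monomialPow_add]
    exact Ideal.mul_mem_right _ _ (Ideal.subset_span ⟨i, rfl⟩)
  | zero => simp
  | add x y _ _ hx hy => rw [add_mul]; exact add_mem hx hy
  | smul r x _ hx => rw [smul_eq_mul, mul_assoc]; exact Ideal.mul_mem_left _ _ hx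

/-- For `m` in the socle of the monoid ideal, the `R`-linear map `R ⧸ ⟨h⟩ → R ⧸ ⟨h ^ M⟩`,
`c ↦ c h̄ ^ m`. -/
def socMonomial (m : monoidSocle (monoidIdeal M)) :
    (R ⧸ seqIdeal h) →ₗ[R] R ⧸ monomialIdeal h M :=
  Submodule.liftQ (seqIdeal h)
    (LinearMap.toSpanSingleton R (R ⧸ monomialIdeal h M)
      (Ideal.Quotient.mk (monomialIdeal h M) (monomialPow h m)))
    fun a ha => by
      rw [LinearMap.mem_ker, LinearMap.toSpanSingleton_apply, Algebra.smul_def,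
        Ideal.Quotient.algebraMap_eq, ← map_mul, Ideal.Quotient.eq_zero_iff_mem]
      exact mul_monomialPow_mem h M m.2 ha

/-- For `m ∈ ℕ ^ t`, the `R`-linear map `R ⧸ ⟨h⟩ → gr_h̄ (R ⧸ ⟨h ^ M⟩)`, `c ↦ c σ(h̄ ^ m)`, where
`σ` is the symbol map. -/
def symbolMonomial (m : Fin t → ℕ) : (R ⧸ seqIdeal h) →ₗ[R] (residueIdeal h M).Gr :=
  Submodule.liftQ (seqIdeal h)
    (LinearMap.toSpanSingleton R (residueIdeal h M).Gr
      ((residueIdeal h M).symbol (Ideal.Quotient.mk (monomialIdeal h M) (monomialPow h m))))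
    fun a ha => by
      rw [LinearMap.mem_ker, LinearMap.toSpanSingleton_apply]
      refine Ideal.smul_gr_eq_zero _ ?_ _
      have := Ideal.mem_map_of_mem (Ideal.Quotient.mk (monomialIdeal h M)) ha
      rwa [Ideal.map_span, ← Set.range_comp] at this

/-- The map `(c_m) ↦ ∑ m, c_m h̄ ^ m` from the free `R ⧸ ⟨h⟩`-module on the socle of the monoid
ideal to `R ⧸ ⟨h ^ M⟩`. -/
def socSum : (monoidSocle (monoidIdeal M) →₀ R ⧸ seqIdeal h) →ₗ[R] R ⧸ monomialIdeal h M :=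
  Finsupp.lsum ℕ fun m => socMonomial h M m

/-- The map `(c_m) ↦ ∑ m, c_m σ(h̄ ^ m)` from the free `R ⧸ ⟨h⟩`-module on the socle of the monoid
ideal to `gr_h̄ (R ⧸ ⟨h ^ M⟩)`. -/
def symbolSum :
    (monoidSocle (monoidIdeal M) →₀ R ⧸ seqIdeal h) →ₗ[R] (residueIdeal h M).Gr :=
  Finsupp.lsum ℕ fun m => symbolMonomial h M m

end Monomial

end

/-! The associated graded ring `G` is a monomial algebra over `R ⧸ ⟨h⟩`, its socle can be read off
from exponents, and the socle of `A = R ⧸ ⟨h ^ M⟩` follows by successive approximation along the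
powers of `⟨h̄⟩`.

A regular sequence is quasi-regular (`mem_seqIdeal_of_monomialEval_mem_pow`): a form of degree `l`
whose value at `h` lies in `⟨h⟩ ^ (l + 1)` has all coefficients in `⟨h⟩`. It follows that an element
of `⟨h ^ M⟩ ∩ ⟨h⟩ ^ k` is a combination of monomials with exponent in `𝕄` and degree at least `k`
(`mem_span_monomialPow_of_mem`). Hence the classes of `h̄ ^ n` with `n ∉ 𝕄` form a basis of `G` over
`R ⧸ ⟨h⟩`, and those with `n ∈ 𝕄` vanish (`grEval_surjective`, `mem_seqIdeal_of_grEval_eq_zero`,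
`grMonomial_eq_zero`).

The bigraded maximal ideal of `G` is generated by `𝔪` in degree zero and by the classes of the `h̄
j`. Multiplication by such a class shifts exponents injectively, so an element killed by all of them
involves only exponents in the socle of `𝕄`; being killed by `𝔪` puts its coefficients into the
socle of `R ⧸ ⟨h⟩` (`exists_symbolSum_eq`).

An element of the socle of `A` lying in `⟨h̄⟩ ^ l` has its degree `l` class in the socle of `G`, so
modulo `⟨h̄⟩ ^ (l + 1)` it equals a combination of socle monomials of degree `l`, again in the socle
of `A`. Subtract and repeat. The socle of `𝕄` is finite, so from some degree on nothing is
subtracted, the remainder lies in every power of `⟨h̄⟩`, and Krull's intersection theorem for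
\*local rings makes it zero (`exists_socSum_eq`). Comparison of lowest degree terms gives the symbol
formula (`symbol_socSum`) and the injectivity of `α` from that of `β`. -/

noncomputable section

/-! ### Regular sequences are quasi-regular -/

section QuasiRegular

variable {R : Type*} [CommRing R] {t u : ℕ}

/-- The exponents of total degree `l` that involve only the first `i` variables. -/
def initExponents (t i l : ℕ) : Set (Fin t → ℕ) :=
  {n | ∑ j, n j = l ∧ ∀ j : Fin t, i ≤ j → n j = 0}

/-- The ideal generated by the first `i` members of the sequence `h`. -/
abbrev initIdeal (h : Fin t → R) (i : ℕ) : Ideal R := Ideal.span (h '' {j | (j : ℕ) < i})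

/-- The value at `h` of the polynomial with coefficients `c`. -/
def monomialEval (h : Fin t → R) : ((Fin t → ℕ) →₀ R) →ₗ[R] R :=
  Finsupp.linearCombination R (monomialPow h)

theorem sum_add_single (n : Fin t → ℕ) (j : Fin t) :
    ∑ k, (n + Pi.single j 1 : Fin t → ℕ) k = ∑ k, n k + 1 := by
  simp [Finset.sum_add_distrib]

theorem monomialPow_add_single (h : Fin t → R) (n : Fin t → ℕ) (j : Fin t) :
    monomialPow h (n + Pi.single j 1) = monomialPow h n * h j := by
  rw [monomialPow_add, monomialPow_single]

theorem sub_single_add_single {n : Fin t → ℕ} {j : Fin t} (hn : n j ≠ 0) :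
    n - Pi.single j 1 + Pi.single j 1 = n := by
  funext k
  rcases eq_or_ne k j with rfl | hk
  · simp only [Pi.add_apply, Pi.sub_apply, Pi.single_eq_same]; omega
  · simp [Pi.single_eq_of_ne hk]

theorem exists_ne_zero_of_sum_eq_succ {n : Fin t → ℕ} {l : ℕ} (hn : ∑ j, n j = l + 1) :
    ∃ j, n j ≠ 0 := by
  by_contra! H
  simp [H] at hn

theorem initIdeal_pow (h : Fin t → R) (i l : ℕ) :
    initIdeal h i ^ l = Ideal.span (monomialPow h '' initExponents t i l) := by
  induction l with
  | zero =>
    rw [pow_zero, Ideal.one_eq_top, eq_comm, Ideal.eq_top_iff_one]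
    exact Ideal.subset_span ⟨0, ⟨by simp, by simp⟩, by simp [monomialPow]⟩
  | succ l ih =>
    rw [pow_succ, ih, initIdeal, Ideal.span_mul_span']
    congr 1
    ext x
    simp only [Set.mem_mul, Set.mem_image]
    constructor
    · rintro ⟨_, ⟨n, hn, rfl⟩, _, ⟨j, hj, rfl⟩, rfl⟩
      refine ⟨n + Pi.single j 1, ⟨by rw [sum_add_single, hn.1], fun k hk => ?_⟩,
        monomialPow_add_single h n j⟩
      have hkj : k ≠ j := by
        rintro rfl
        exact absurd hj (by simpa using hk)
      simp [hn.2 k hk, Pi.single_eq_of_ne hkj]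
    · rintro ⟨n, hn, rfl⟩
      obtain ⟨j, hj⟩ := exists_ne_zero_of_sum_eq_succ hn.1
      have hn' := sub_single_add_single hj
      refine ⟨_, ⟨n - Pi.single j 1, ⟨?_, fun k hk => ?_⟩, rfl⟩, _, ⟨j, ?_, rfl⟩, ?_⟩
      · have := sum_add_single (n - Pi.single j 1) j
        rw [hn', hn.1] at this
        omega
      · simp [hn.2 k hk]
      · by_contra hji
        exact hj (hn.2 j (by simpa using hji))
      · rw [← monomialPow_add_single, hn']

/-- Used with `K = ⊤` to represent an element of a power of the ideal by a form, and with `K` the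
ideal itself to represent an element of the next power by a form of the same degree with
coefficients in the ideal. -/
theorem exists_monomialEval_eq (h : Fin t → R) (K : Ideal R) {i l : ℕ} {x : R}
    (hx : x ∈ K * initIdeal h i ^ l) :
    ∃ c ∈ Finsupp.supported R R (initExponents t i l), (∀ n, c n ∈ K) ∧ monomialEval h c = x := by
  rw [initIdeal_pow, ← smul_eq_mul, Ideal.span,
    Submodule.mem_ideal_smul_span_iff_exists_sum'] at hx
  obtain ⟨a, ha, rfl⟩ := hx
  refine ⟨a.mapDomain Subtype.val, ?_, fun n => ?_, ?_⟩
  · rw [Finsupp.mem_supported]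
    intro n hn
    classical
    obtain ⟨m, -, rfl⟩ := Finset.mem_image.1 (Finsupp.mapDomain_support hn)
    exact m.2
  · by_cases hn : n ∈ initExponents t i l
    · rw [← Subtype.coe_mk n hn, Finsupp.mapDomain_apply Subtype.val_injective]
      exact ha _
    · rw [Finsupp.mapDomain_of_notMem_range _ _ (by simpa using hn)]
      exact K.zero_mem
  · rw [monomialEval, Finsupp.linearCombination_mapDomain, Finsupp.linearCombination_apply]
    rfl

theorem monomialEval_mem (h : Fin t → R) (K : Ideal R) {i l : ℕ} {c : (Fin t → ℕ) →₀ R}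
    (hc : c ∈ Finsupp.supported R R (initExponents t i l)) (hK : ∀ n, c n ∈ K) :
    monomialEval h c ∈ K * initIdeal h i ^ l := by
  rw [monomialEval, Finsupp.linearCombination_apply]
  refine Ideal.sum_mem _ fun n hn => Ideal.mul_mem_mul (hK n) ?_
  rw [initIdeal_pow]
  exact Ideal.subset_span ⟨n, (Finsupp.mem_supported _ _).1 hc hn, rfl⟩

theorem initIdeal_mono (h : Fin t → R) {i j : ℕ} (hij : i ≤ j) : initIdeal h i ≤ initIdeal h j :=
  Ideal.span_mono (Set.image_mono fun k (hk : (k : ℕ) < i) => lt_of_lt_of_le hk hij)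

theorem initIdeal_eq_seqIdeal (h : Fin t → R) : initIdeal h t = seqIdeal h := by
  rw [initIdeal, seqIdeal, ← Set.image_univ]
  congr 2
  ext j; simp

/-- If the forms of degree `l` vanishing at `h` have coefficients in the ideal, then so do those
whose value lies in the next power of the ideal. -/
theorem mem_of_monomialEval_mem_pow (h : Fin t → R) {i l : ℕ}
    (H : ∀ c ∈ Finsupp.supported R R (initExponents t i l), monomialEval h c = 0 →
      ∀ n, c n ∈ initIdeal h i)
    {c : (Fin t → ℕ) →₀ R} (hc : c ∈ Finsupp.supported R R (initExponents t i l))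
    (hev : monomialEval h c ∈ initIdeal h i ^ (l + 1)) (n : Fin t → ℕ) : c n ∈ initIdeal h i := by
  rw [pow_succ'] at hev
  -- The value is also taken by a form `e` of degree `l` with coefficients in the ideal, so `H`
  -- applies to the difference.
  obtain ⟨e, he, heK, heq⟩ := exists_monomialEval_eq h _ hev
  have := H (c - e) (Submodule.sub_mem _ hc he) (by rw [map_sub, heq, sub_self]) n
  simpa using add_mem this (heK n)

/-- A nonzerodivisor modulo an ideal with the quasi-regularity property `H` stays one modulo its
powers. If `x` is the value of a form of degree `l` and `r * x` lies one power deeper, then `r`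
times each coefficient lies in the ideal, hence so does each coefficient. -/
theorem mul_mem_initIdeal_pow (h : Fin t → R) {i : ℕ} {r : R}
    (hr : ∀ x, r * x ∈ initIdeal h i → x ∈ initIdeal h i)
    (H : ∀ l, ∀ c ∈ Finsupp.supported R R (initExponents t i l), monomialEval h c = 0 →
      ∀ n, c n ∈ initIdeal h i)
    {l : ℕ} {x : R} (hx : r * x ∈ initIdeal h i ^ l) : x ∈ initIdeal h i ^ l := by
  induction l with
  | zero => simp
  | succ l ih =>
    have hxl := ih (Ideal.pow_le_pow_right l.le_succ hx)
    obtain ⟨c, hc, -, rfl⟩ := exists_monomialEval_eq h ⊤ (i := i) (l := l) (x := x)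
      (by rwa [Ideal.top_mul])
    rw [pow_succ']
    refine monomialEval_mem h _ hc fun n => hr _ ?_
    have := mem_of_monomialEval_mem_pow h (H l) (c := r • c) (Submodule.smul_mem _ _ hc)
      (by rwa [map_smul, smul_eq_mul]) n
    simpa using this

/-- Double induction, on the number of variables and then on the degree. Split `c = G + X_j H`,
where `X_j` is the last variable and `G` does not involve it. From `G(h) = - h j * H(h)` and the
regularity of `h j` modulo powers of the smaller ideal, `H(h)` lies in the power `l + 1` of that
ideal. This controls `H` by induction on the degree, and `G` by induction on the number of variables
after replacing `H(h)` by the value of a form in the earlier variables. -/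
theorem mem_initIdeal_of_monomialEval_eq_zero (h : Fin t → R)
    (hr : ∀ (i : Fin t) (x : R), h i * x ∈ initIdeal h i → x ∈ initIdeal h i) {i : ℕ} (hi : i ≤ t) :
    ∀ l, ∀ c ∈ Finsupp.supported R R (initExponents t i l), monomialEval h c = 0 →
      ∀ n, c n ∈ initIdeal h i := by
  induction i with
  | zero =>
    intro l c hc h0 n
    have hs : ∀ n, n ≠ 0 → c n = 0 := by
      intro n hn
      by_contra hcn
      have hm := (Finsupp.mem_supported _ _).1 hc (Finsupp.mem_support_iff.2 hcn)
      exact hn (funext fun j => hm.2 j (Nat.zero_le _))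
    have hc0 : c = Finsupp.single 0 (c 0) := by
      ext n
      rcases eq_or_ne n 0 with rfl | hn
      · simp
      · rw [hs n hn, Finsupp.single_eq_of_ne hn]
    rw [hc0, monomialEval, Finsupp.linearCombination_single] at h0
    have h0 : c 0 = 0 := by simpa [monomialPow] using h0
    rcases eq_or_ne n 0 with rfl | hn
    · rw [h0]; exact zero_mem _
    · rw [hs n hn]; exact zero_mem _
  | succ i ih =>
    have ih := ih (by omega)
    intro l
    induction l with
    | zero =>
      intro c hc h0 n
      -- In degree zero only the exponent `0` occurs, so the form already belongs to the case of
      -- fewer variables.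
      refine initIdeal_mono h i.le_succ (ih 0 c ?_ h0 n)
      have hsub : initExponents t (i + 1) 0 ⊆ initExponents t i 0 := fun n hn =>
        ⟨hn.1, fun j _ => Finset.sum_eq_zero_iff.1 hn.1 j (Finset.mem_univ j)⟩
      exact Finsupp.supported_mono hsub hc
    | succ l ihl =>
      intro c hc h0
      set j : Fin t := ⟨i, by omega⟩ with hj
      have hinj : Function.Injective fun n : Fin t → ℕ => n + Pi.single j 1 :=
        add_left_injective _
      set G := c.filter (fun n => n j = 0) with hG
      set H := c.comapDomain (fun n => n + Pi.single j 1) hinj.injOn with hH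
      have hcs : ∀ n, c n ≠ 0 → n ∈ initExponents t (i + 1) (l + 1) := fun n hn =>
        (Finsupp.mem_supported _ _).1 hc (Finsupp.mem_support_iff.2 hn)
      have hGs : G ∈ Finsupp.supported R R (initExponents t i (l + 1)) := by
        rw [Finsupp.mem_supported]
        intro n hn
        rw [hG, Finsupp.support_filter, Finset.coe_filter] at hn
        have hm := hcs n (Finsupp.mem_support_iff.1 hn.1)
        refine ⟨hm.1, fun k hk => ?_⟩
        rcases eq_or_lt_of_le hk with hk | hk
        · rw [← hn.2]; congr 1; ext; simp [hj, hk]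
        · exact hm.2 k hk
      have hHs : H ∈ Finsupp.supported R R (initExponents t (i + 1) l) := by
        rw [Finsupp.mem_supported]
        intro n hn
        have hm := hcs (n + Pi.single j 1) (by simpa [hH] using hn)
        refine ⟨by have := hm.1; rw [sum_add_single] at this; omega, fun k hk => ?_⟩
        have := hm.2 k hk
        rw [Pi.add_apply] at this
        omega
      have hcGH : c = G + H.mapDomain fun n => n + Pi.single j 1 := by
        ext n
        rw [Finsupp.add_apply]
        by_cases hn : n j = 0
        · rw [hG, Finsupp.filter_apply_pos (fun n : Fin t → ℕ => n j = 0) c hn, Finsupp.mapDomain_of_notMem_range, add_zero]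
          rintro ⟨k, rfl⟩
          simp at hn
        · rw [hG, Finsupp.filter_apply_neg (fun n : Fin t → ℕ => n j = 0) c hn, zero_add]
          have e : n = (fun n : Fin t → ℕ => n + Pi.single j 1) (n - Pi.single j 1) :=
            (sub_single_add_single hn).symm
          rw [e, Finsupp.mapDomain_apply hinj]
          simp [hH]
      have hevH : monomialEval h (H.mapDomain fun n => n + Pi.single j 1) =
          h j * monomialEval h H := by
        rw [monomialEval, Finsupp.linearCombination_mapDomain, Finsupp.linearCombination_apply,
          Finsupp.linearCombination_apply, Finsupp.sum, Finsupp.sum, Finset.mul_sum]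
        refine Finset.sum_congr rfl fun n _ => ?_
        simp only [Function.comp_apply, smul_eq_mul, monomialPow_add_single]
        ring
      have hsum : monomialEval h G + h j * monomialEval h H = 0 := by
        rw [← hevH, ← map_add, ← hcGH, h0]
      have hGm : monomialEval h G ∈ initIdeal h i ^ (l + 1) := by
        simpa [Ideal.top_mul] using monomialEval_mem h ⊤ hGs (fun _ => trivial)
      have hHm : monomialEval h H ∈ initIdeal h i ^ (l + 1) := by
        refine mul_mem_initIdeal_pow h (hr j) ih ?_
        rw [← neg_eq_of_add_eq_zero_right hsum]
        exact neg_mem hGm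
      -- `H'` has the same value as `H` but has degree `l + 1` and avoids the last variable, so that
      -- `G + h j • H'` is a vanishing form to which the outer induction applies.
      obtain ⟨H', hHs', -, hHe'⟩ := exists_monomialEval_eq h ⊤ (i := i) (l := l + 1)
        (x := monomialEval h H) (by rwa [Ideal.top_mul])
      have hH1 : ∀ n, H n ∈ initIdeal h (i + 1) :=
        mem_of_monomialEval_mem_pow h ihl hHs
          (Ideal.pow_right_mono (initIdeal_mono h i.le_succ) _ hHm)
      have hG1 : ∀ n, G n ∈ initIdeal h (i + 1) := by
        intro n
        have := ih (l + 1) (G + h j • H')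
          (Submodule.add_mem _ hGs (Submodule.smul_mem _ _ hHs'))
          (by rw [map_add, map_smul, hHe', smul_eq_mul, hsum]) n
        have hjm : h j * H' n ∈ initIdeal h (i + 1) :=
          Ideal.mul_mem_right _ _ (Ideal.subset_span ⟨j, by simp [hj], rfl⟩)
        simpa using sub_mem (initIdeal_mono h i.le_succ this) hjm
      intro n
      by_cases hn : n j = 0
      · have := hG1 n
        rwa [hG, Finsupp.filter_apply_pos (fun n : Fin t → ℕ => n j = 0) c hn] at this
      · have := hH1 (n - Pi.single j 1)
        rwa [hH, Finsupp.comapDomain_apply, sub_single_add_single hn] at this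

theorem mul_mem_initIdeal_of_isWeaklyRegular {h : Fin t → R}
    (hreg : RingTheory.Sequence.IsWeaklyRegular R (List.ofFn h)) (i : Fin t) (x : R)
    (hx : h i * x ∈ initIdeal h i) : x ∈ initIdeal h i := by
  have key := hreg.regular_mod_prev i (by simp)
  have hI : Ideal.ofList ((List.ofFn h).take i) • (⊤ : Submodule R R) = initIdeal h i := by
    rw [smul_eq_mul, ← Ideal.one_eq_top, mul_one, Ideal.ofList, initIdeal]
    congr 1
    ext y
    simp only [Set.mem_ofPred_eq, Set.mem_image, List.mem_take_iff_getElem, List.getElem_ofFn,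
      List.length_ofFn]
    constructor
    · rintro ⟨k, hk, rfl⟩
      exact ⟨⟨k, by omega⟩, by simp; omega, rfl⟩
    · rintro ⟨k, hk, rfl⟩
      exact ⟨k, by simp; omega, rfl⟩
  rw [hI] at key
  rw [← Ideal.Quotient.eq_zero_iff_mem] at hx ⊢
  have := @key (Ideal.Quotient.mk _ x) 0 (by
    simp only [smul_zero, List.getElem_ofFn]
    exact hx)
  exact this

/-- A regular sequence is quasi-regular. -/
theorem mem_seqIdeal_of_monomialEval_mem_pow {h : Fin t → R}
    (hreg : RingTheory.Sequence.IsWeaklyRegular R (List.ofFn h)) {l : ℕ} {c : (Fin t → ℕ) →₀ R}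
    (hc : c ∈ Finsupp.supported R R {n : Fin t → ℕ | ∑ j, n j = l})
    (hev : monomialEval h c ∈ seqIdeal h ^ (l + 1)) (n : Fin t → ℕ) : c n ∈ seqIdeal h := by
  rw [← initIdeal_eq_seqIdeal] at hev ⊢
  refine mem_of_monomialEval_mem_pow h (mem_initIdeal_of_monomialEval_eq_zero h
    (mul_mem_initIdeal_of_isWeaklyRegular hreg) le_rfl l) ?_ hev n
  have hsub : {n : Fin t → ℕ | ∑ j, n j = l} ⊆ initExponents t t l := fun n hn =>
    ⟨hn, fun j hj => absurd j.2 (by omega)⟩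
  exact Finsupp.supported_mono hsub hc

/-! ### Powers of `⟨h⟩` and monomial ideals -/

theorem seqIdeal_pow (h : Fin t → R) (l : ℕ) :
    seqIdeal h ^ l = Ideal.span (monomialPow h '' {n | ∑ j, n j = l}) := by
  rw [← initIdeal_eq_seqIdeal, initIdeal_pow]
  congr 2
  ext n
  exact ⟨fun hn => hn.1, fun hn => ⟨hn, fun j hj => absurd j.2 (by omega)⟩⟩

theorem monomialPow_mem_seqIdeal_pow (h : Fin t → R) (n : Fin t → ℕ) :
    monomialPow h n ∈ seqIdeal h ^ (∑ j, n j) := by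
  rw [seqIdeal_pow]
  exact Ideal.subset_span ⟨n, rfl, rfl⟩

theorem mem_monoidIdeal_add {M : Matrix (Fin u) (Fin t) ℕ} {n : Fin t → ℕ}
    (hn : n ∈ monoidIdeal M) (k : Fin t → ℕ) : n + k ∈ monoidIdeal M := by
  obtain ⟨i, k', rfl⟩ := hn
  exact ⟨i, k' + k, add_assoc _ _ _⟩

theorem monomialPow_mem_monomialIdeal (h : Fin t → R) {M : Matrix (Fin u) (Fin t) ℕ}
    {n : Fin t → ℕ} (hn : n ∈ monoidIdeal M) : monomialPow h n ∈ monomialIdeal h M := by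
  obtain ⟨i, k, rfl⟩ := hn
  rw [monomialPow_add]
  exact Ideal.mul_mem_right _ _ (Ideal.subset_span ⟨i, rfl⟩)

/-- An element of order at least `k` of the monomial ideal is a combination of monomials of degree
at least `k` in the ideal. -/
theorem mem_span_monomialPow_of_mem {h : Fin t → R}
    (hreg : RingTheory.Sequence.IsWeaklyRegular R (List.ofFn h)) (M : Matrix (Fin u) (Fin t) ℕ)
    (k : ℕ) {x : R} (hx : x ∈ monomialIdeal h M) (hxk : x ∈ seqIdeal h ^ k) :
    x ∈ Ideal.span (monomialPow h '' {n | n ∈ monoidIdeal M ∧ k ≤ ∑ j, n j}) := by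
  induction k with
  | zero =>
    refine Ideal.span_mono ?_ hx
    rintro _ ⟨i, rfl⟩
    exact ⟨M i, ⟨⟨i, 0, by simp⟩, Nat.zero_le _⟩, rfl⟩
  | succ k ih =>
    obtain ⟨e, he, rfl⟩ := (Finsupp.mem_span_image_iff_linearCombination R).1
      (ih (Ideal.pow_le_pow_right k.le_succ hxk))
    have hes : ∀ n, e n ≠ 0 → n ∈ monoidIdeal M ∧ k ≤ ∑ j, n j := fun n hn =>
      (Finsupp.mem_supported _ _).1 he (Finsupp.mem_support_iff.2 hn)
    change monomialEval h e ∈ _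
    change monomialEval h e ∈ _ at hxk
    have hsplit := Finsupp.filter_add_filter_not e (fun n => ∑ j, n j = k)
    set e₁ := e.filter (fun n => ∑ j, n j = k) with he₁
    set e₂ := e.filter (fun n => ¬ ∑ j, n j = k) with he₂
    have h2 : monomialEval h e₂ ∈
        Ideal.span (monomialPow h '' {n | n ∈ monoidIdeal M ∧ k + 1 ≤ ∑ j, n j}) := by
      refine (Finsupp.mem_span_image_iff_linearCombination R).2 ⟨e₂, ?_, rfl⟩
      rw [Finsupp.mem_supported]
      intro n hn
      rw [he₂, Finsupp.support_filter, Finset.coe_filter] at hn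
      have := hes n (Finsupp.mem_support_iff.1 hn.1)
      exact ⟨this.1, lt_of_le_of_ne this.2 (Ne.symm hn.2)⟩
    have h2' : monomialEval h e₂ ∈ seqIdeal h ^ (k + 1) := by
      refine (Ideal.span_le.2 ?_) h2
      rintro _ ⟨n, hn, rfl⟩
      exact Ideal.pow_le_pow_right hn.2 (monomialPow_mem_seqIdeal_pow h n)
    rw [← hsplit, map_add] at hxk ⊢
    refine add_mem ?_ h2
    -- The part of degree exactly `k` has value in the next power, so its coefficients lie in `⟨h⟩`.
    -- Each factor `h j` of a coefficient is then absorbed into its monomial, which moves to degree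
    -- `k + 1` within the monoid ideal.
    have h1 := mem_seqIdeal_of_monomialEval_mem_pow hreg (c := e₁) (l := k) (by
      rw [Finsupp.mem_supported]
      intro n hn
      rw [he₁, Finsupp.support_filter, Finset.coe_filter] at hn
      exact hn.2) ((add_mem_cancel_right h2').1 hxk)
    rw [monomialEval, Finsupp.linearCombination_apply]
    refine Ideal.sum_mem _ fun n hn => ?_
    rw [he₁, Finsupp.support_filter, Finset.mem_filter] at hn
    have hnM := (hes n (Finsupp.mem_support_iff.1 hn.1)).1
    have h1n := h1 n
    dsimp only
    generalize e₁ n = r at h1n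
    induction h1n using Submodule.span_induction with
    | mem r hr =>
      obtain ⟨j, rfl⟩ := hr
      rw [smul_eq_mul, mul_comm, ← monomialPow_add_single]
      exact Ideal.subset_span ⟨_, ⟨mem_monoidIdeal_add hnM _, by rw [sum_add_single, hn.2]⟩, rfl⟩
    | zero => simp
    | add a b _ _ ha hb => rw [add_smul]; exact add_mem ha hb
    | smul a b _ hb => rw [smul_assoc]; exact Submodule.smul_mem _ _ hb

/-- Monomials outside the monomial ideal are independent over `R ⧸ ⟨h⟩` in the associated graded
ring of the monomial quotient. -/
theorem mem_seqIdeal_of_monomialEval_mem_sup {h : Fin t → R}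
    (hreg : RingTheory.Sequence.IsWeaklyRegular R (List.ofFn h)) (M : Matrix (Fin u) (Fin t) ℕ)
    {l : ℕ} {c : (Fin t → ℕ) →₀ R}
    (hc : c ∈ Finsupp.supported R R {n : Fin t → ℕ | ∑ j, n j = l})
    (hev : monomialEval h c ∈ seqIdeal h ^ (l + 1) ⊔ monomialIdeal h M) {n : Fin t → ℕ}
    (hn : n ∉ monoidIdeal M) : c n ∈ seqIdeal h := by
  obtain ⟨a, ha, b, hb, hab⟩ := Submodule.mem_sup.1 hev
  have hcl : monomialEval h c ∈ seqIdeal h ^ l := by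
    rw [seqIdeal_pow]
    exact (Finsupp.mem_span_image_iff_linearCombination R).2 ⟨c, hc, rfl⟩
  have hbl : b ∈ seqIdeal h ^ l := by
    rw [← hab] at hcl
    exact (add_mem_cancel_left (Ideal.pow_le_pow_right l.le_succ ha)).1 hcl
  obtain ⟨e, he, rfl⟩ := (Finsupp.mem_span_image_iff_linearCombination R).1
    (mem_span_monomialPow_of_mem hreg M l hb hbl)
  have hes : ∀ n, e n ≠ 0 → n ∈ monoidIdeal M ∧ l ≤ ∑ j, n j := fun n hn =>
    (Finsupp.mem_supported _ _).1 he (Finsupp.mem_support_iff.2 hn)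
  change a + monomialEval h e = _ at hab
  have hsplit := Finsupp.filter_add_filter_not e (fun n => ∑ j, n j = l)
  set e₁ := e.filter (fun n => ∑ j, n j = l) with he₁
  set e₂ := e.filter (fun n => ¬ ∑ j, n j = l) with he₂
  have h2 : monomialEval h e₂ ∈ seqIdeal h ^ (l + 1) := by
    rw [monomialEval, Finsupp.linearCombination_apply]
    refine Ideal.sum_mem _ fun n hn => Ideal.mul_mem_left _ _ ?_
    rw [he₂, Finsupp.support_filter, Finset.mem_filter] at hn
    have := (hes n (Finsupp.mem_support_iff.1 hn.1)).2
    exact Ideal.pow_le_pow_right (lt_of_le_of_ne this (Ne.symm hn.2))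
      (monomialPow_mem_seqIdeal_pow h n)
  -- Subtracting the degree `l` part of the element of `⟨h ^ M⟩` brings the value into `⟨h⟩ ^ (l +
  -- 1)`. Exponents outside the monoid ideal are unaffected, since `e₁` vanishes there.
  have key := mem_seqIdeal_of_monomialEval_mem_pow hreg (c := c - e₁) (l := l)
    (Submodule.sub_mem _ hc (by
      rw [Finsupp.mem_supported]
      intro n hn
      rw [he₁, Finsupp.support_filter, Finset.coe_filter] at hn
      exact hn.2)) (by
      rw [map_sub, ← hab, ← hsplit, map_add]
      convert add_mem ha h2 using 1
      ring) n
  have hen : e₁ n = 0 := by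
    by_contra hne
    rw [he₁, Finsupp.filter_apply] at hne
    exact hn (hes n (by intro h0; simp [h0] at hne)).1
  simpa [hen] using key

end QuasiRegular

/-! ### A criterion for \*local rings -/

section StarLocalCriterion

variable {ι S : Type*} [CommRing S]

/-- The proper homogeneous ideal `𝔪` contains all homogeneous elements that are not units. -/
structure IsStarLocalWith (𝒮 : ι → AddSubgroup S) (𝔪 : Ideal S) : Prop where
  isHomogeneousIdeal : IsHomogeneousIdeal 𝒮 𝔪
  ne_top : 𝔪 ≠ ⊤
  isUnit : ∀ i, ∀ x ∈ 𝒮 i, x ∉ 𝔪 → IsUnit x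

namespace IsStarLocalWith

variable {𝒮 : ι → AddSubgroup S} {𝔪 : Ideal S}

theorem le_of_isHomogeneousIdeal (H : IsStarLocalWith 𝒮 𝔪) {J : Ideal S}
    (hJ : IsHomogeneousIdeal 𝒮 J) (hne : J ≠ ⊤) : J ≤ 𝔪 := by
  rw [← show _ = J from hJ]
  refine Ideal.span_le.2 fun x hx => ?_
  obtain ⟨hxJ, i, hi⟩ := hx
  by_contra hxm
  exact hne (Ideal.eq_top_of_isUnit_mem _ hxJ (H.isUnit i x hi hxm))

theorem isStarMaximal (H : IsStarLocalWith 𝒮 𝔪) : IsStarMaximal 𝒮 𝔪 :=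
  ⟨⟨H.isHomogeneousIdeal, H.ne_top⟩, fun _ hJ _ => H.le_of_isHomogeneousIdeal hJ.1 hJ.2⟩

theorem isStarLocal (H : IsStarLocalWith 𝒮 𝔪) : IsStarLocal 𝒮 :=
  ⟨𝔪, H.isStarMaximal, fun _ hJ =>
    hJ.eq_of_le H.isStarMaximal.1 (H.le_of_isHomogeneousIdeal hJ.1.1 hJ.1.2)⟩

theorem mem_starSocle_iff (H : IsStarLocalWith 𝒮 𝔪) {x : S} :
    x ∈ starSocle 𝒮 ↔ ∀ a ∈ 𝔪, a * x = 0 := by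
  rw [starSocle, H.isStarMaximal.starMaximalIdeal_eq H.isStarLocal, Submodule.mem_annihilator]
  simp only [smul_eq_mul, mul_comm x]

/-- Homogeneous elements of the quotient lift to homogeneous elements, and units map to units; `J ≤
𝔪` keeps the image of `𝔪` proper. -/
theorem quotient (H : IsStarLocalWith 𝒮 𝔪) {J : Ideal S} (hJ : J ≤ 𝔪) :
    IsStarLocalWith (quotientGrading 𝒮 J) (𝔪.map (Ideal.Quotient.mk J)) := by
  have hmem : ∀ x, Ideal.Quotient.mk J x ∈ 𝔪.map (Ideal.Quotient.mk J) ↔ x ∈ 𝔪 := fun x => by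
    rw [Ideal.mem_quotient_iff_mem_sup, sup_eq_left.2 hJ]
  refine ⟨le_antisymm (Ideal.span_le.2 fun x hx => hx.1) ?_, ?_, ?_⟩
  · conv_lhs => rw [← show _ = 𝔪 from H.isHomogeneousIdeal]
    rw [Ideal.map_span]
    refine Ideal.span_mono ?_
    rintro _ ⟨x, ⟨hx, i, hi⟩, rfl⟩
    exact ⟨(hmem x).2 hx, i, AddSubgroup.mem_map_of_mem _ hi⟩
  · rw [Ne, Ideal.eq_top_iff_one, ← map_one (Ideal.Quotient.mk J), hmem, ← Ideal.eq_top_iff_one]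
    exact H.ne_top
  · rintro i _ ⟨x, hx, rfl⟩ hxm
    exact (H.isUnit i x hx fun h => hxm ((hmem x).2 h)).map (Ideal.Quotient.mk J)

end IsStarLocalWith

theorem isHomogeneousIdeal_span {𝒮 : ι → AddSubgroup S} {s : Set S} (hs : ∀ x ∈ s, ∃ i, x ∈ 𝒮 i) :
    IsHomogeneousIdeal 𝒮 (Ideal.span s) :=
  le_antisymm (Ideal.span_le.2 fun _ hx => hx.1)
    (Ideal.span_mono fun x hx => ⟨Ideal.subset_span hx, hs x hx⟩)

/-- A homogeneous nonunit generates a proper homogeneous ideal. The Noetherian condition places it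
in a \*maximal ideal, which is `𝔪` by uniqueness. -/
theorem IsStarLocal.exists_isStarLocalWith [IsNoetherianRing S] {𝒮 : ι → AddSubgroup S}
    (H : IsStarLocal 𝒮) : ∃ 𝔪, IsStarLocalWith 𝒮 𝔪 := by
  obtain ⟨𝔪, h𝔪, huniq⟩ := H
  refine ⟨𝔪, h𝔪.1.1, h𝔪.1.2, fun i x hx hxm => ?_⟩
  by_contra hu
  obtain ⟨J, ⟨hJ, hle⟩, hmax⟩ := (wellFounded_gt (α := Ideal S)).has_min
    {J | (IsHomogeneousIdeal 𝒮 J ∧ J ≠ ⊤) ∧ Ideal.span {x} ≤ J}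
    ⟨Ideal.span {x}, ⟨isHomogeneousIdeal_span (by rintro _ rfl; exact ⟨i, hx⟩),
      fun h => hu (Ideal.span_singleton_eq_top.1 h)⟩, le_rfl⟩
  have hJ' : IsStarMaximal 𝒮 J := ⟨hJ, fun K hK hJK => by
    by_contra hKJ
    exact hmax K ⟨hK, hle.trans hJK⟩ (lt_of_le_not_ge hJK hKJ)⟩
  rw [huniq J hJ'] at hle
  exact hxm (hle (Ideal.mem_span_singleton_self x))

end StarLocalCriterion

/-! ### The intersection theorem for \*local rings -/

section Krull

variable {R : Type*} [CommRing R] [IsNoetherianRing R] {𝒜 : ℤ → AddSubgroup R} [GradedRing 𝒜]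
  {𝔪 : Ideal R}

/-- The intersection pulls back to a homogeneous ideal, so a homogeneous `y` suffices. Krull's
theorem gives `r ∈ I` with `(1 - r) * y ∈ Q`; comparing components in the degree of `y` replaces `r`
by its degree zero component `r₀`. Then `1 - r₀` is homogeneous and outside `𝔪`, hence a unit. -/
theorem IsStarLocalWith.iInf_map_pow_eq_bot (H : IsStarLocalWith 𝒜 𝔪) {I Q : Ideal R}
    (hI : I.IsHomogeneous 𝒜) (hQ : Q.IsHomogeneous 𝒜) (hle : I ≤ 𝔪) :
    ⨅ k : ℕ, I.map (Ideal.Quotient.mk Q) ^ k = ⊥ := by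
  have hmem : ∀ x, Ideal.Quotient.mk Q x ∈ ⨅ k : ℕ, I.map (Ideal.Quotient.mk Q) ^ k ↔
      x ∈ ⨅ k : ℕ, I ^ k ⊔ Q := fun x => by
    simp only [Ideal.mem_iInf, ← Ideal.map_pow, Ideal.mem_quotient_iff_mem_sup]
  have hpow : ∀ k : ℕ, (I ^ k).IsHomogeneous 𝒜 := fun k => by
    induction k with
    | zero => rw [pow_zero, Ideal.one_eq_top]; exact Ideal.IsHomogeneous.top 𝒜
    | succ k ih => rw [pow_succ]; exact ih.mul hI
  have hN : (⨅ k : ℕ, I ^ k ⊔ Q).IsHomogeneous 𝒜 :=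
    Ideal.IsHomogeneous.iInf fun k => (hpow k).sup hQ
  rw [eq_bot_iff]
  intro x hx
  obtain ⟨x, rfl⟩ := Ideal.Quotient.mk_surjective x
  rw [hmem] at hx
  rw [Ideal.mem_bot, Ideal.Quotient.eq_zero_iff_mem]
  classical
  rw [← DirectSum.sum_support_decompose 𝒜 x]
  refine Ideal.sum_mem _ fun d _ => ?_
  have hxd := (hmem _).2 (hN d hx)
  generalize hy : ((DirectSum.decompose 𝒜 x d : 𝒜 d) : R) = y at hxd
  have hyd : y ∈ 𝒜 d := hy ▸ SetLike.coe_mem _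
  obtain ⟨⟨r, hr⟩, hrx⟩ := (Ideal.mem_iInf_smul_pow_eq_bot_iff (I.map (Ideal.Quotient.mk Q))
    (Ideal.Quotient.mk Q y)).1 (by simpa using hxd)
  obtain ⟨r, hrI, rfl⟩ := (Ideal.mem_map_iff_of_surjective _ Ideal.Quotient.mk_surjective).1 hr
  have h1 : (1 - r) * y ∈ Q := by
    rw [← Ideal.Quotient.eq_zero_iff_mem]
    have : Ideal.Quotient.mk Q r * Ideal.Quotient.mk Q y = Ideal.Quotient.mk Q y := hrx
    rw [sub_mul, one_mul, map_sub, map_mul, this, sub_self]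
  set r₀ : R := ((DirectSum.decompose 𝒜 r 0 : 𝒜 0) : R) with hr₀
  have h2 : (1 - r₀) * y ∈ Q := by
    have := hQ (0 + d) h1
    rw [DirectSum.coe_decompose_mul_add_of_right_mem 𝒜 hyd, DirectSum.decompose_sub] at this
    rw [DirectSum.sub_apply, AddSubgroup.coe_sub,
      DirectSum.decompose_of_mem_same 𝒜 (SetLike.GradedOne.one_mem (A := 𝒜))] at this
    exact this
  have h0 : 1 - r₀ ∈ 𝒜 0 := sub_mem (SetLike.GradedOne.one_mem) (SetLike.coe_mem _)
  have hu : IsUnit (1 - r₀) := H.isUnit 0 _ h0 fun hm => by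
    refine H.ne_top ((Ideal.eq_top_iff_one _).2 ?_)
    have := add_mem hm (hle (hI 0 hrI))
    rwa [← hr₀, sub_add_cancel] at this
  exact (Ideal.unit_mul_mem_iff_mem _ hu).1 h2

end Krull

/-! ### Elements of the associated graded ring -/

namespace Ideal

variable {A : Type*} [CommRing A] (I : Ideal A)

/-- The class in degree `l` of the associated graded ring of an element of `I ^ l`. -/
def grTerm (l : ℕ) (x : A) (hx : x ∈ I ^ l) : I.Gr := I.grOf l (I.grMk l ⟨x, hx⟩)

variable {I}

theorem grTerm_congr {l k : ℕ} {x y : A} {hx : x ∈ I ^ l} {hy : y ∈ I ^ k} (hlk : l = k)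
    (hxy : x = y) : I.grTerm l x hx = I.grTerm k y hy := by
  subst hlk hxy; rfl

theorem grOf_injective (l : ℕ) : Function.Injective (I.grOf l) :=
  DirectSum.of_injective (β := I.GrPiece) l

theorem exists_grTerm_eq (l : ℕ) (c : I.GrPiece l) : ∃ x hx, I.grTerm l x hx = I.grOf l c := by
  induction c using Submodule.Quotient.induction_on with | _ x =>
  exact ⟨x, x.2, rfl⟩

theorem grTerm_eq_zero_iff {l : ℕ} {x : A} {hx : x ∈ I ^ l} :
    I.grTerm l x hx = 0 ↔ x ∈ I ^ (l + 1) := by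
  rw [grTerm, ← map_zero (I.grOf l), (grOf_injective l).eq_iff]
  exact grMk_eq_iff.trans (by rw [ZeroMemClass.coe_zero, sub_zero])

theorem grTerm_add {l : ℕ} {x y : A} (hx : x ∈ I ^ l) (hy : y ∈ I ^ l) :
    I.grTerm l (x + y) (add_mem hx hy) = I.grTerm l x hx + I.grTerm l y hy :=
  map_add (I.grOf l) (I.grMk l ⟨x, hx⟩) (I.grMk l ⟨y, hy⟩)

theorem grTerm_eq_iff {l : ℕ} {x y : A} {hx : x ∈ I ^ l} {hy : y ∈ I ^ l} :
    I.grTerm l x hx = I.grTerm l y hy ↔ x - y ∈ I ^ (l + 1) := by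
  rw [grTerm, grTerm, (grOf_injective l).eq_iff]
  exact grMk_eq_iff

theorem grTerm_mul {l k : ℕ} {x y : A} (hx : x ∈ I ^ l) (hy : y ∈ I ^ k) :
    I.grTerm l x hx * I.grTerm k y hy =
      I.grTerm (l + k) (x * y) (by rw [pow_add]; exact mul_mem_mul hx hy) :=
  DirectSum.of_mul_of (A := I.GrPiece) _ _

theorem algebraMap_gr {R : Type*} [CommRing R] [Algebra R A] (r : R) :
    algebraMap R I.Gr r = I.grTerm 0 (algebraMap R A r) (by simp) := rfl

theorem smul_grTerm {R : Type*} [CommRing R] [Algebra R A] (r : R) {l : ℕ} {x : A}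
    (hx : x ∈ I ^ l) : r • I.grTerm l x hx =
      I.grTerm l (r • x) (by rw [Algebra.smul_def]; exact mul_mem_left _ _ hx) := by
  rw [Algebra.smul_def, algebraMap_gr, grTerm_mul]
  exact grTerm_congr (zero_add l) (Algebra.smul_def r x).symm

theorem symbol_eq_grTerm {l : ℕ} {x : A} (hx : x ∈ I ^ l) (hx' : x ∉ I ^ (l + 1)) :
    I.symbol x = I.grTerm l x hx := by
  have hex : ∃ k, x ∉ I ^ (k + 1) := ⟨l, hx'⟩
  have hg := I.isGreatest_ordNat x hex
  have hl : I.ordNat x hex = l := by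
    refine le_antisymm ?_ (hg.2 hx)
    by_contra hlt
    exact hx' (pow_le_pow_right (by omega) hg.1)
  rw [symbol, dif_pos hex]
  exact grTerm_congr hl rfl

theorem symbol_eq_zero {x : A} (hx : ∀ k, x ∈ I ^ k) : I.symbol x = 0 := by
  rw [symbol, dif_neg]
  push Not
  exact fun k => hx _

theorem symbol_zero : I.symbol 0 = 0 := symbol_eq_zero fun _ => zero_mem _

theorem exists_symbol_eq (x : A) (hx : ∃ k, x ∉ I ^ k) :
    ∃ l, ∃ hl : x ∈ I ^ l, x ∉ I ^ (l + 1) ∧ I.symbol x = I.grTerm l x hl := by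
  obtain ⟨k, hk⟩ := hx
  have hex : ∃ k, x ∉ I ^ (k + 1) := ⟨k, fun h => hk (pow_le_pow_right k.le_succ h)⟩
  have hg := I.isGreatest_ordNat x hex
  have : x ∉ I ^ (I.ordNat x hex + 1) := fun h => by
    have : I.ordNat x hex + 1 ≤ I.ordNat x hex := hg.2 h
    omega
  exact ⟨_, hg.1, this, symbol_eq_grTerm hg.1 this⟩

theorem gr_induction {p : I.Gr → Prop} (zero : p 0) (add : ∀ y z, p y → p z → p (y + z))
    (term : ∀ l x hx, p (I.grTerm l x hx)) (y : I.Gr) : p y := by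
  change ⨁ l, I.GrPiece l at y
  induction y using DirectSum.induction_on with
  | zero => exact zero
  | add y z hy hz => exact add y z hy hz
  | of l c =>
    obtain ⟨x, hx, h⟩ := exists_grTerm_eq l c
    have := term l x hx
    rwa [h] at this

/-- The map from a piece of the associated graded ring to a residue ring of degree zero. -/
def grAugPiece {𝔪 : Ideal A} (hI : I ≤ 𝔪) : ∀ l, I.GrPiece l →+ A ⧸ 𝔪
  | 0 => QuotientAddGroup.lift _
      ((Ideal.Quotient.mk 𝔪 : A →+ A ⧸ 𝔪).comp (I ^ 0).subtype.toAddMonoidHom) (by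
        intro x hx
        have hx : (x : A) ∈ I ^ (0 + 1) := hx
        rw [zero_add, pow_one] at hx
        exact Ideal.Quotient.eq_zero_iff_mem.2 (hI hx))
  | _ + 1 => 0

/-- The projection of the associated graded ring onto a residue ring of its piece of degree zero. -/
def grAug {𝔪 : Ideal A} (hI : I ≤ 𝔪) : I.Gr →+* A ⧸ 𝔪 :=
  DirectSum.toSemiring (A := I.GrPiece) (grAugPiece hI) (map_one (Ideal.Quotient.mk 𝔪)) (by
    rintro (_ | i) (_ | j) a b
    · induction a using Submodule.Quotient.induction_on with | _ x =>
      induction b using Submodule.Quotient.induction_on with | _ y =>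
      exact map_mul (Ideal.Quotient.mk 𝔪) _ _
    · exact (mul_zero _).symm
    · exact (zero_mul _).symm
    · exact (zero_mul _).symm)

theorem grAug_grTerm_zero {𝔪 : Ideal A} (hI : I ≤ 𝔪) (x : A) (hx : x ∈ I ^ 0) :
    grAug hI (I.grTerm 0 x hx) = Ideal.Quotient.mk 𝔪 x :=
  DirectSum.toSemiring_of (A := I.GrPiece) _ _ _ _ _

theorem grAug_grTerm_succ {𝔪 : Ideal A} (hI : I ≤ 𝔪) (l : ℕ) (x : A) (hx : x ∈ I ^ (l + 1)) :
    grAug hI (I.grTerm (l + 1) x hx) = 0 :=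
  DirectSum.toSemiring_of (A := I.GrPiece) _ _ _ _ _

theorem grTerm_mem_grBigrading {ι : Type*} {𝒜 : ι → AddSubgroup A} {d : ι} {l : ℕ} {x : A}
    (hx : x ∈ I ^ l) (hd : x ∈ 𝒜 d) : I.grTerm l x hx ∈ I.grBigrading 𝒜 (l, d) :=
  AddSubgroup.mem_map_of_mem _ (AddSubgroup.mem_map_of_mem _
    (show (⟨x, hx⟩ : ↥(I ^ l)) ∈ (𝒜 d).comap (I ^ l).subtype.toAddMonoidHom from hd))

theorem exists_of_mem_grBigrading {ι : Type*} {𝒜 : ι → AddSubgroup A} {p : ℕ × ι} {y : I.Gr}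
    (hy : y ∈ I.grBigrading 𝒜 p) : ∃ x ∈ 𝒜 p.2, ∃ hx : x ∈ I ^ p.1, y = I.grTerm p.1 x hx := by
  obtain ⟨_, ⟨x, hx, rfl⟩, rfl⟩ := hy
  exact ⟨x, hx, x.2, rfl⟩

variable {κ : Type*} (g : κ → A)

/-- The class of degree one of a generator of the ideal. -/
def grVar (j : κ) : (span (Set.range g)).Gr :=
  grTerm _ 1 (g j) (by rw [pow_one]; exact subset_span ⟨j, rfl⟩)

/-- The ideal of the associated graded ring generated by `𝔪` in degree zero and by the classes of
the generators in degree one. -/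
def grIdeal (𝔪 : Ideal A) : Ideal (span (Set.range g)).Gr :=
  𝔪.map (algebraMap A (span (Set.range g)).Gr) ⊔ span (Set.range (grVar g))

/-- The power `l + 1` is generated by products of an element of the power `l` with a generator `g
j`, whose class is a multiple of `grVar g j`. -/
theorem grTerm_succ_mem_grIdeal (𝔪 : Ideal A) (l : ℕ) (x : A)
    (hx : x ∈ span (Set.range g) ^ (l + 1)) : grTerm _ (l + 1) x hx ∈ grIdeal g 𝔪 := by
  -- The membership proof is part of the data of `grTerm`, so it is carried existentially through
  -- the induction.
  suffices H : ∀ x ∈ span (Set.range g) ^ (l + 1),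
      ∃ hx, grTerm (span (Set.range g)) (l + 1) x hx ∈ grIdeal g 𝔪 from (H x hx).2
  intro x hx
  rw [pow_succ] at hx
  have hadd : ∀ x y, (∃ hx, grTerm (span (Set.range g)) (l + 1) x hx ∈ grIdeal g 𝔪) →
      (∃ hx, grTerm (span (Set.range g)) (l + 1) y hx ∈ grIdeal g 𝔪) →
      ∃ hx, grTerm (span (Set.range g)) (l + 1) (x + y) hx ∈ grIdeal g 𝔪 := by
    rintro x y ⟨hx, hx'⟩ ⟨hy, hy'⟩
    exact ⟨add_mem hx hy, by rw [grTerm_add hx hy]; exact add_mem hx' hy'⟩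
  induction hx using Submodule.mul_induction_on' with
  | mem_mul_mem x hx y hy =>
    induction hy using Submodule.span_induction with
    | mem y hy =>
      obtain ⟨j, rfl⟩ := hy
      refine ⟨by rw [pow_succ]; exact mul_mem_mul hx (subset_span ⟨j, rfl⟩), ?_⟩
      rw [← grTerm_mul hx (by rw [pow_one]; exact subset_span ⟨j, rfl⟩)]
      exact mul_mem_left _ _ (mem_sup_right (subset_span ⟨j, rfl⟩))
    | zero =>
      refine ⟨by simp, ?_⟩
      rw [grTerm_eq_zero_iff.2 (by simp)]
      exact zero_mem _
    | add y z _ _ hy hz => rw [mul_add]; exact hadd _ _ hy hz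
    | smul r y _ hy =>
      obtain ⟨hy, hy'⟩ := hy
      refine ⟨by rw [mul_smul_comm]; exact Submodule.smul_mem _ r hy, ?_⟩
      rw [← grTerm_congr (hx := Submodule.smul_mem _ r hy) rfl (mul_smul_comm r x y).symm, ← smul_grTerm r hy, Algebra.smul_def]
      exact mul_mem_left _ _ hy'
  | add x _ y _ hx hy => exact hadd x y hx hy

end Ideal

open Ideal in
-- A bihomogeneous element of positive first degree lies in `grIdeal`; one of first degree zero
-- comes from a homogeneous element of `A`, where `H` applies.
theorem IsStarLocalWith.gr {ι A κ : Type*} [CommRing A] {𝒜 : ι → AddSubgroup A} {𝔪 : Ideal A}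
    (H : IsStarLocalWith 𝒜 𝔪) (g : κ → A) (hg : ∀ j, ∃ i, g j ∈ 𝒜 i) (hle : ∀ j, g j ∈ 𝔪) :
    IsStarLocalWith ((Ideal.span (Set.range g)).grBigrading 𝒜) (grIdeal g 𝔪) := by
  have hI : Ideal.span (Set.range g) ≤ 𝔪 := Ideal.span_le.2 (by rintro _ ⟨j, rfl⟩; exact hle j)
  refine ⟨?_, ?_, ?_⟩
  · have : grIdeal g 𝔪 = Ideal.span ((algebraMap A (Ideal.span (Set.range g)).Gr) ''
        {x | x ∈ 𝔪 ∧ ∃ i, x ∈ 𝒜 i} ∪ Set.range (grVar g)) := by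
      rw [Ideal.span_union, ← Ideal.map_span, show _ = 𝔪 from H.isHomogeneousIdeal, grIdeal]
    rw [this]
    refine isHomogeneousIdeal_span ?_
    rintro _ (⟨x, ⟨-, i, hi⟩, rfl⟩ | ⟨j, rfl⟩)
    · exact ⟨(0, i), grTerm_mem_grBigrading _ hi⟩
    · obtain ⟨i, hi⟩ := hg j
      exact ⟨(1, i), grTerm_mem_grBigrading _ hi⟩
  · intro htop
    -- Properness: the projection onto `A ⧸ 𝔪` kills `grIdeal` but not `1`.
    have : grIdeal g 𝔪 ≤ RingHom.ker (grAug hI) := by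
      refine sup_le (Ideal.map_le_iff_le_comap.2 fun a ha => ?_) (Ideal.span_le.2 ?_)
      · rw [Ideal.mem_comap, RingHom.mem_ker, algebraMap_gr, grAug_grTerm_zero]
        exact Ideal.Quotient.eq_zero_iff_mem.2 ha
      · rintro _ ⟨j, rfl⟩
        exact grAug_grTerm_succ hI 0 _ _
    rw [htop, top_le_iff] at this
    have h1 : (1 : (Ideal.span (Set.range g)).Gr) ∈ RingHom.ker (grAug hI) := by rw [this]; trivial
    rw [RingHom.mem_ker, map_one, ← map_one (Ideal.Quotient.mk 𝔪),
      Ideal.Quotient.eq_zero_iff_mem] at h1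
    exact H.ne_top ((Ideal.eq_top_iff_one _).2 h1)
  · rintro ⟨l, i⟩ y hy hym
    obtain ⟨x, hxi, hxl, rfl⟩ := exists_of_mem_grBigrading hy
    rcases l with _ | l
    · have hx : x ∉ 𝔪 := fun hx => hym (Ideal.mem_sup_left (Ideal.mem_map_of_mem _ hx))
      exact (H.isUnit i x hxi hx).map (algebraMap A (Ideal.span (Set.range g)).Gr)
    · exact absurd (grTerm_succ_mem_grIdeal g 𝔪 l x hxl) hym

/-! ### Homogeneous components of the associated graded ring -/

namespace Ideal

variable {A : Type*} [CommRing A] {I : Ideal A}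

/-- The homogeneous component of degree `l` of an element of the associated graded ring. -/
def grComponent (l : ℕ) : I.Gr →+ I.Gr :=
  (I.grOf l).comp (DirectSum.component ℤ ℕ I.GrPiece l).toAddMonoidHom

theorem grComponent_grOf_self (l : ℕ) (c : I.GrPiece l) :
    grComponent l (I.grOf l c) = I.grOf l c :=
  congrArg (I.grOf l) (DirectSum.of_eq_same (β := I.GrPiece) l c)

theorem grComponent_grTerm_of_ne {l k : ℕ} (hkl : k ≠ l) {x : A} (hx : x ∈ I ^ k) :
    grComponent l (I.grTerm k x hx) = 0 :=
  (congrArg (I.grOf l) (DirectSum.of_eq_of_ne (β := I.GrPiece) k l _ (Ne.symm hkl))).trans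
    (map_zero _)

theorem exists_sum_eq_grTerm {ι : Type*} (s : Finset ι) {l : ℕ} (x : ι → A) (y : ι → I.Gr)
    (H : ∀ i ∈ s, ∃ hx, y i = I.grTerm l (x i) hx) :
    ∃ hx, ∑ i ∈ s, y i = I.grTerm l (∑ i ∈ s, x i) hx := by
  classical
  induction s using Finset.induction_on with
  | empty => exact ⟨by simp, (grTerm_eq_zero_iff.2 (by simp)).symm⟩
  | insert a s ha ih =>
    obtain ⟨hx, h⟩ := ih fun i hi => H i (Finset.mem_insert_of_mem hi)
    obtain ⟨hx', h'⟩ := H a (Finset.mem_insert_self a s)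
    refine ⟨by rw [Finset.sum_insert ha]; exact add_mem hx' hx, ?_⟩
    rw [Finset.sum_insert ha, h, h', ← grTerm_add hx' hx]
    exact grTerm_congr rfl (Finset.sum_insert ha).symm

end Ideal

/-! ### The associated graded ring of a monomial quotient -/

section MonomialQuotient

open Ideal

variable {R : Type*} [CommRing R] {t u : ℕ} (h : Fin t → R) (M : Matrix (Fin u) (Fin t) ℕ)

theorem residueIdeal_eq_map :
    residueIdeal h M = (seqIdeal h).map (Ideal.Quotient.mk (monomialIdeal h M)) := by
  rw [seqIdeal, Ideal.map_span, ← Set.range_comp]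
  rfl

theorem mk_mem_residueIdeal_pow_iff {l : ℕ} {x : R} :
    Ideal.Quotient.mk (monomialIdeal h M) x ∈ residueIdeal h M ^ l ↔
      x ∈ seqIdeal h ^ l ⊔ monomialIdeal h M := by
  rw [residueIdeal_eq_map, ← Ideal.map_pow, Ideal.mem_quotient_iff_mem_sup]

theorem mk_monomialPow_mem (n : Fin t → ℕ) :
    Ideal.Quotient.mk (monomialIdeal h M) (monomialPow h n) ∈ residueIdeal h M ^ (∑ j, n j) :=
  (mk_mem_residueIdeal_pow_iff h M).2 (Ideal.mem_sup_left (monomialPow_mem_seqIdeal_pow h n))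

/-- The class of the monomial `h ^ n` in its degree. -/
def grMonomial (n : Fin t → ℕ) : (residueIdeal h M).Gr :=
  grTerm _ (∑ j, n j) _ (mk_monomialPow_mem h M n)

/-- The combination of the classes of monomials with coefficients `c`. -/
def grEval : ((Fin t → ℕ) →₀ R) →ₗ[R] (residueIdeal h M).Gr :=
  Finsupp.linearCombination R (grMonomial h M)

variable {M} in
theorem grMonomial_eq_zero {n : Fin t → ℕ} (hn : n ∈ monoidIdeal M) : grMonomial h M n = 0 := by
  rw [grMonomial, grTerm_eq_zero_iff,
    Ideal.Quotient.eq_zero_iff_mem.2 (monomialPow_mem_monomialIdeal h hn)]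
  exact zero_mem _

theorem grVar_mul_grMonomial (j : Fin t) (n : Fin t → ℕ) :
    grVar (fun j => Ideal.Quotient.mk (monomialIdeal h M) (h j)) j * grMonomial h M n =
      grMonomial h M (n + Pi.single j 1) := by
  rw [grVar, grMonomial, grTerm_mul]
  refine grTerm_congr (by rw [sum_add_single, add_comm]) ?_
  rw [monomialPow_add_single, map_mul, mul_comm]

theorem grVar_mul_grEval (j : Fin t) (c : (Fin t → ℕ) →₀ R) :
    grVar (fun j => Ideal.Quotient.mk (monomialIdeal h M) (h j)) j * grEval h M c =
      grEval h M (c.mapDomain fun n => n + Pi.single j 1) := by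
  rw [grEval, Finsupp.linearCombination_mapDomain, Finsupp.linearCombination_apply,
    Finsupp.linearCombination_apply, Finsupp.sum, Finsupp.sum, Finset.mul_sum]
  refine Finset.sum_congr rfl fun n _ => ?_
  rw [mul_smul_comm, grVar_mul_grMonomial, Function.comp_apply]

theorem grEval_eq_grTerm {l : ℕ} {c : (Fin t → ℕ) →₀ R}
    (hc : c ∈ Finsupp.supported R R {n : Fin t → ℕ | ∑ j, n j = l}) :
    ∃ hx, grEval h M c =
      grTerm _ l (Ideal.Quotient.mk (monomialIdeal h M) (monomialEval h c)) hx := by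
  have key := exists_sum_eq_grTerm (I := residueIdeal h M) (l := l) c.support
    (fun n => Ideal.Quotient.mk (monomialIdeal h M) (c n • monomialPow h n))
    (fun n => c n • grMonomial h M n) (fun n hn => by
      have hl : ∑ j, n j = l := (Finsupp.mem_supported _ _).1 hc hn
      subst hl
      exact ⟨_, smul_grTerm _ (mk_monomialPow_mem h M n)⟩)
  rw [← map_sum] at key
  exact key

theorem grEval_surjective : Function.Surjective (grEval h M) := by
  intro y
  induction y using gr_induction with
  | zero => exact ⟨0, map_zero _⟩
  | add y z hy hz =>
    obtain ⟨c, rfl⟩ := hy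
    obtain ⟨d, rfl⟩ := hz
    exact ⟨c + d, map_add _ _ _⟩
  | term l x hx =>
    obtain ⟨r, rfl⟩ := Ideal.Quotient.mk_surjective x
    obtain ⟨a, ha, b, hb, hab⟩ := Submodule.mem_sup.1 ((mk_mem_residueIdeal_pow_iff h M).1 hx)
    rw [seqIdeal_pow] at ha
    obtain ⟨c, hc, rfl⟩ := (Finsupp.mem_span_image_iff_linearCombination R).1 ha
    obtain ⟨hx', h'⟩ := grEval_eq_grTerm h M hc
    refine ⟨c, h'.trans (grTerm_congr rfl ?_)⟩
    rw [← hab, map_add, Ideal.Quotient.eq_zero_iff_mem.2 hb, add_zero]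
    rfl

theorem grComponent_grEval (l : ℕ) (c : (Fin t → ℕ) →₀ R) :
    grComponent l (grEval h M c) = grEval h M (c.filter fun n => ∑ j, n j = l) := by
  induction c using Finsupp.induction_linear with
  | zero => rw [map_zero, map_zero, Finsupp.filter_zero, map_zero]
  | add c d hc hd => rw [map_add, map_add, hc, hd, Finsupp.filter_add, map_add]
  | single n r =>
    have hr : grEval h M (Finsupp.single n r) = grTerm _ _ _
        (Submodule.smul_of_tower_mem _ r (mk_monomialPow_mem h M n)) := by
      rw [grEval, Finsupp.linearCombination_single, grMonomial, smul_grTerm]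
    by_cases hn : ∑ j, n j = l
    · rw [Finsupp.filter_single_of_pos (p := fun n : Fin t → ℕ => ∑ j, n j = l) hn, hr]
      subst hn
      exact grComponent_grOf_self _ _
    · rw [Finsupp.filter_single_of_neg (p := fun n : Fin t → ℕ => ∑ j, n j = l) hn, hr, grComponent_grTerm_of_ne hn, map_zero]

variable {h}

/-- Together with `grMonomial_eq_zero` and `grEval_surjective` this presents `G` as a monomial
algebra over `R ⧸ ⟨h⟩`. Passing to the component of degree `∑ j, n j` turns the relation into
membership in `⟨h⟩ ^ (l + 1) ⊔ ⟨h ^ M⟩`. -/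
theorem mem_seqIdeal_of_grEval_eq_zero
    (hreg : RingTheory.Sequence.IsWeaklyRegular R (List.ofFn h)) {c : (Fin t → ℕ) →₀ R}
    (hc : grEval h M c = 0) {n : Fin t → ℕ} (hn : n ∉ monoidIdeal M) : c n ∈ seqIdeal h := by
  set l := ∑ j, n j with hl
  have h0 := grComponent_grEval h M l c
  rw [hc, map_zero] at h0
  have hs : c.filter (fun n => ∑ j, n j = l) ∈
      Finsupp.supported R R {n : Fin t → ℕ | ∑ j, n j = l} := by
    rw [Finsupp.mem_supported, Finsupp.support_filter, Finset.coe_filter]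
    exact fun n hn => hn.2
  obtain ⟨hx, h'⟩ := grEval_eq_grTerm h M hs
  rw [h', eq_comm, grTerm_eq_zero_iff, mk_mem_residueIdeal_pow_iff] at h0
  have := mem_seqIdeal_of_monomialEval_mem_sup hreg M hs h0 hn
  rwa [Finsupp.filter_apply_pos (fun n : Fin t → ℕ => ∑ j, n j = l) c hl.symm] at this

/-- Outside the monoid ideal the order of `h̄ ^ n` is exactly its degree, since otherwise its
coefficient `1` would lie in `⟨h⟩`. Inside, both sides vanish. -/
theorem symbol_mk_monomialPow (hreg : RingTheory.Sequence.IsWeaklyRegular R (List.ofFn h))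
    (hne : seqIdeal h ≠ ⊤) (n : Fin t → ℕ) :
    (residueIdeal h M).symbol (Ideal.Quotient.mk (monomialIdeal h M) (monomialPow h n)) =
      grMonomial h M n := by
  by_cases hn : n ∈ monoidIdeal M
  · rw [grMonomial_eq_zero h hn,
      Ideal.Quotient.eq_zero_iff_mem.2 (monomialPow_mem_monomialIdeal h hn), symbol_zero]
  · refine symbol_eq_grTerm (mk_monomialPow_mem h M n) fun hmem => hne ?_
    rw [mk_mem_residueIdeal_pow_iff] at hmem
    have hs : Finsupp.single n (1 : R) ∈
        Finsupp.supported R R {k : Fin t → ℕ | ∑ j, k j = ∑ j, n j} :=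
      Finsupp.single_mem_supported R _ rfl
    have := mem_seqIdeal_of_monomialEval_mem_sup hreg M hs
      (by rwa [monomialEval, Finsupp.linearCombination_single, one_smul]) hn
    rwa [Finsupp.single_eq_same, ← Ideal.eq_top_iff_one] at this

theorem symbolMonomial_mk (hreg : RingTheory.Sequence.IsWeaklyRegular R (List.ofFn h))
    (hne : seqIdeal h ≠ ⊤) (m : Fin t → ℕ) (r : R) :
    symbolMonomial h M m (Ideal.Quotient.mk _ r) = r • grMonomial h M m := by
  rw [← symbol_mk_monomialPow M hreg hne]
  rfl

theorem symbolMonomial_eq_grTerm (hreg : RingTheory.Sequence.IsWeaklyRegular R (List.ofFn h))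
    (hne : seqIdeal h ≠ ⊤) (m : monoidSocle (monoidIdeal M)) (c : R ⧸ seqIdeal h) :
    ∃ hx, symbolMonomial h M m c = grTerm _ (∑ j, m.1 j) (socMonomial h M m c) hx := by
  obtain ⟨r, rfl⟩ := Ideal.Quotient.mk_surjective c
  rw [symbolMonomial_mk M hreg hne]
  exact ⟨_, smul_grTerm r (mk_monomialPow_mem h M m)⟩

theorem socMonomial_mem (m : monoidSocle (monoidIdeal M)) (c : R ⧸ seqIdeal h) :
    socMonomial h M m c ∈ residueIdeal h M ^ (∑ j, m.1 j) := by
  obtain ⟨r, rfl⟩ := Ideal.Quotient.mk_surjective c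
  exact Submodule.smul_of_tower_mem _ r (mk_monomialPow_mem h M m)

theorem socSum_mem_pow {k : ℕ} {c : monoidSocle (monoidIdeal M) →₀ R ⧸ seqIdeal h}
    (hc : ∀ m, ∑ j, m.1 j < k → c m = 0) : socSum h M c ∈ residueIdeal h M ^ k := by
  rw [socSum, Finsupp.lsum_apply]
  refine Ideal.sum_mem _ fun m hm => ?_
  refine Ideal.pow_le_pow_right ?_ (socMonomial_mem M m (c m))
  by_contra hlt
  exact (Finsupp.mem_support_iff.1 hm) (hc m (by omega))

/-- This links `α` and `β`: on combinations of a single degree, `β` is the class of `α`. -/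
theorem symbolSum_eq_grTerm (hreg : RingTheory.Sequence.IsWeaklyRegular R (List.ofFn h))
    (hne : seqIdeal h ≠ ⊤) {d : ℕ} {c : monoidSocle (monoidIdeal M) →₀ R ⧸ seqIdeal h}
    (hc : ∀ m, c m ≠ 0 → ∑ j, m.1 j = d) :
    ∃ hx, symbolSum h M c = grTerm _ d (socSum h M c) hx := by
  refine exists_sum_eq_grTerm (I := residueIdeal h M) (l := d) c.support
    (fun m => socMonomial h M m (c m)) (fun m => symbolMonomial h M m (c m)) fun m hm => ?_
  rw [← hc m (Finsupp.mem_support_iff.1 hm)]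
  exact symbolMonomial_eq_grTerm M hreg hne m (c m)

theorem grComponent_symbolSum (hreg : RingTheory.Sequence.IsWeaklyRegular R (List.ofFn h))
    (hne : seqIdeal h ≠ ⊤) (l : ℕ) (c : monoidSocle (monoidIdeal M) →₀ R ⧸ seqIdeal h) :
    grComponent l (symbolSum h M c) = symbolSum h M (c.filter fun m => ∑ j, m.1 j = l) := by
  induction c using Finsupp.induction_linear with
  | zero => rw [map_zero, map_zero, Finsupp.filter_zero, map_zero]
  | add c d hc hd => rw [map_add, map_add, hc, hd, Finsupp.filter_add, map_add]
  | single m r =>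
    have hr : symbolSum h M (Finsupp.single m r) = symbolMonomial h M m r := by
      rw [symbolSum, Finsupp.lsum_single]
    obtain ⟨hx, h'⟩ := symbolMonomial_eq_grTerm M hreg hne m r
    by_cases hm : ∑ j, m.1 j = l
    · rw [Finsupp.filter_single_of_pos
        (p := fun m : monoidSocle (monoidIdeal M) => ∑ j, m.1 j = l) hm, hr, h']
      subst hm
      exact grComponent_grOf_self _ _
    · rw [Finsupp.filter_single_of_neg
        (p := fun m : monoidSocle (monoidIdeal M) => ∑ j, m.1 j = l) hm, hr, h', grComponent_grTerm_of_ne hm, map_zero]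

theorem symbolSum_mapRange (hreg : RingTheory.Sequence.IsWeaklyRegular R (List.ofFn h))
    (hne : seqIdeal h ≠ ⊤) (L : monoidSocle (monoidIdeal M) →₀ R) :
    symbolSum h M (L.mapRange (Ideal.Quotient.mk (seqIdeal h)) (map_zero _)) =
      grEval h M (L.mapDomain Subtype.val) := by
  induction L using Finsupp.induction_linear with
  | zero => simp
  | add L K hL hK =>
    rw [Finsupp.mapRange_add (map_add _), map_add, hL, hK, Finsupp.mapDomain_add, map_add]
  | single m r =>
    rw [Finsupp.mapRange_single, Finsupp.mapDomain_single, symbolSum, Finsupp.lsum_single,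
      grEval, Finsupp.linearCombination_single, symbolMonomial_mk M hreg hne]

theorem symbolSum_injective (hreg : RingTheory.Sequence.IsWeaklyRegular R (List.ofFn h))
    (hne : seqIdeal h ≠ ⊤) : Function.Injective (symbolSum h M) := by
  rw [injective_iff_map_eq_zero]
  intro c hc
  obtain ⟨L, rfl⟩ := Finsupp.mapRange_surjective _ (map_zero _)
    (Ideal.Quotient.mk_surjective (I := seqIdeal h)) c
  rw [symbolSum_mapRange M hreg hne] at hc
  ext m
  have := mem_seqIdeal_of_grEval_eq_zero M hreg hc m.2.1
  rw [Finsupp.mapDomain_apply Subtype.val_injective] at this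
  rw [Finsupp.mapRange_apply, Ideal.Quotient.eq_zero_iff_mem.2 this, Finsupp.zero_apply]

/-- The symbol of a combination of socle monomials is given by its terms of lowest degree. -/
theorem symbol_socSum (hreg : RingTheory.Sequence.IsWeaklyRegular R (List.ofFn h))
    (hne : seqIdeal h ≠ ⊤) {d : ℕ} {c : monoidSocle (monoidIdeal M) →₀ R ⧸ seqIdeal h}
    (hc : ∀ m, ∑ j, m.1 j < d → c m = 0) (hcd : c.filter (fun m => ∑ j, m.1 j = d) ≠ 0) :
    socSum h M c ≠ 0 ∧
    (residueIdeal h M).symbol (socSum h M c) =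
      symbolSum h M (c.filter fun m => ∑ j, m.1 j = d) := by
  have hsplit := Finsupp.filter_add_filter_not c (fun m => ∑ j, m.1 j = d)
  set c₁ := c.filter (fun m => ∑ j, m.1 j = d) with hc₁
  set c₂ := c.filter (fun m => ¬ ∑ j, m.1 j = d) with hc₂
  have h2 : socSum h M c₂ ∈ residueIdeal h M ^ (d + 1) := by
    refine socSum_mem_pow M fun m hm => ?_
    rw [hc₂, Finsupp.filter_apply]
    split_ifs with hmd
    · rfl
    · exact hc m (by omega)
  obtain ⟨hx, h1⟩ := symbolSum_eq_grTerm M hreg hne (d := d) (c := c₁) fun m hm => by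
    by_contra hmd
    exact hm (Finsupp.filter_apply_neg _ c hmd)
  -- Injectivity of `β` excludes cancellation among the lowest terms, so the order of the sum is
  -- exactly `d`.
  have hne0 : symbolSum h M c₁ ≠ 0 := fun h0 =>
    hcd (symbolSum_injective M hreg hne (h0.trans (map_zero _).symm))
  have h1' : socSum h M c₁ ∉ residueIdeal h M ^ (d + 1) := by
    rwa [h1, Ne, grTerm_eq_zero_iff] at hne0
  have hsum : socSum h M c = socSum h M c₁ + socSum h M c₂ := by rw [← map_add, hsplit]
  have hmem : socSum h M c ∉ residueIdeal h M ^ (d + 1) := by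
    rwa [hsum, add_mem_cancel_right h2]
  refine ⟨fun h0 => hmem (by rw [h0]; exact zero_mem _), ?_⟩
  rw [h1, symbol_eq_grTerm (socSum_mem_pow M hc) hmem, grTerm_eq_iff, hsum, add_sub_cancel_left]
  exact h2

theorem socSum_injective (hreg : RingTheory.Sequence.IsWeaklyRegular R (List.ofFn h))
    (hne : seqIdeal h ≠ ⊤) : Function.Injective (socSum h M) := by
  rw [injective_iff_map_eq_zero]
  intro c hc
  by_contra h0
  obtain ⟨m, hm, hmin⟩ := c.support.exists_min_image (fun m => ∑ j, m.1 j)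
    (Finsupp.support_nonempty_iff.2 h0)
  refine (symbol_socSum M hreg hne (d := ∑ j, m.1 j) (c := c) ?_ ?_).1 hc
  · intro k hk
    by_contra hck
    exact absurd (hmin k (Finsupp.mem_support_iff.2 hck)) (by simpa using hk)
  · intro hf
    have := DFunLike.congr_fun hf m
    rw [Finsupp.filter_apply, if_pos rfl] at this
    exact Finsupp.mem_support_iff.1 hm this

end MonomialQuotient

/-! ### Socles -/

section Socle

open Ideal

variable {t u : ℕ}

/-- If `m < n` were both in the socle, then `n` would lie in `𝕄`; so the socle is an antichain,
finite by Dickson's lemma. -/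
theorem monoidSocle_finite (𝕄 : Set (Fin t → ℕ)) : (monoidSocle 𝕄).Finite := by
  have hanti : IsAntichain (· ≤ ·) (monoidSocle 𝕄) := by
    intro m hm n hn hne hle
    obtain ⟨k, rfl⟩ := exists_add_of_le hle
    exact hn.1 (hm.2 k fun hk => hne (by simp [hk]))
  exact WellQuasiOrderedLE.finite_of_isAntichain hanti

theorem exists_add_single_notMem {M : Matrix (Fin u) (Fin t) ℕ} {n : Fin t → ℕ}
    (hn : n ∉ monoidIdeal M) (hs : n ∉ monoidSocle (monoidIdeal M)) :
    ∃ j, n + Pi.single j 1 ∉ monoidIdeal M := by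
  by_contra! H
  refine hs ⟨hn, fun k hk => ?_⟩
  obtain ⟨j, hj⟩ := Function.ne_iff.1 hk
  have := mem_monoidIdeal_add (H j) (k - Pi.single j 1)
  rwa [add_assoc, add_comm (Pi.single j 1), sub_single_add_single hj] at this

variable {R : Type*} [CommRing R] {𝒜 : ℤ → AddSubgroup R} {𝔪 : Ideal R}

theorem IsStarLocalWith.mem_starSocle_quotient_iff (H : IsStarLocalWith 𝒜 𝔪) {J : Ideal R}
    (hJ : J ≤ 𝔪) {x : R ⧸ J} :
    x ∈ starSocle (quotientGrading 𝒜 J) ↔ ∀ a ∈ 𝔪, a • x = 0 := by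
  rw [(H.quotient hJ).mem_starSocle_iff]
  constructor
  · intro hx a ha
    rw [Algebra.smul_def]
    exact hx _ (Ideal.mem_map_of_mem _ ha)
  · intro hx a ha
    obtain ⟨b, hb, rfl⟩ := (Ideal.mem_map_iff_of_surjective _ Ideal.Quotient.mk_surjective).1 ha
    have := hx b hb
    rwa [Algebra.smul_def] at this

variable (h : Fin t → R) (M : Matrix (Fin u) (Fin t) ℕ)

theorem mem_starSocle_gr_iff (H : IsStarLocalWith 𝒜 𝔪)
    (hhom : ∀ j, SetLike.IsHomogeneousElem 𝒜 (h j)) (hle : seqIdeal h ≤ 𝔪)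
    (hQ : monomialIdeal h M ≤ 𝔪) :
    IsStarLocalWith ((residueIdeal h M).grBigrading (quotientGrading 𝒜 (monomialIdeal h M)))
      (grIdeal (fun j => Ideal.Quotient.mk (monomialIdeal h M) (h j))
        (𝔪.map (Ideal.Quotient.mk (monomialIdeal h M)))) ∧
    ∀ y, y ∈ starSocle
        ((residueIdeal h M).grBigrading (quotientGrading 𝒜 (monomialIdeal h M))) ↔
      (∀ a ∈ 𝔪, a • y = 0) ∧
        ∀ j, grVar (fun j => Ideal.Quotient.mk (monomialIdeal h M) (h j)) j * y = 0 := by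
  have HG := (H.quotient hQ).gr (fun j => Ideal.Quotient.mk (monomialIdeal h M) (h j))
    (fun j => by
      obtain ⟨i, hi⟩ := hhom j
      exact ⟨i, AddSubgroup.mem_map_of_mem _ hi⟩)
    (fun j => Ideal.mem_map_of_mem _ (hle (Ideal.subset_span ⟨j, rfl⟩)))
  refine ⟨HG, fun y => ?_⟩
  have hsm : ∀ a : R, a • y = algebraMap (R ⧸ monomialIdeal h M) (residueIdeal h M).Gr
      (Ideal.Quotient.mk _ a) * y := fun a => Algebra.smul_def _ _
  refine HG.mem_starSocle_iff.trans ⟨fun hy => ⟨fun a ha => ?_, fun j => ?_⟩, fun hy => ?_⟩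
  · rw [hsm]
    exact hy _ (Ideal.mem_sup_left (Ideal.mem_map_of_mem _ (Ideal.mem_map_of_mem _ ha)))
  · exact hy _ (Ideal.mem_sup_right (Ideal.subset_span ⟨j, rfl⟩))
  · have hker : grIdeal (fun j => Ideal.Quotient.mk (monomialIdeal h M) (h j))
        (𝔪.map (Ideal.Quotient.mk (monomialIdeal h M))) ≤ (Ideal.span {y}).annihilator := by
      refine sup_le (Ideal.map_le_iff_le_comap.2 ?_) (Ideal.span_le.2 ?_)
      · refine Ideal.map_le_iff_le_comap.2 fun a ha => ?_
        rw [Ideal.mem_comap, Ideal.mem_comap]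
        exact (Submodule.mem_annihilator_span_singleton _ _).2 ((hsm a).symm.trans (hy.1 a ha))
      · rintro _ ⟨j, rfl⟩
        exact (Submodule.mem_annihilator_span_singleton _ _).2 (hy.2 j)
    exact fun a ha => (Submodule.mem_annihilator_span_singleton _ _).1 (hker ha)

variable {h}

/-- Write `y` as a combination of monomial classes. An exponent outside `𝕄` and its socle stays
outside `𝕄` after some shift by a unit vector, so `hy'` forces its coefficient into `⟨h⟩`, which
annihilates `G`. Terms with exponent in `𝕄` vanish, and `hy` controls the remaining coefficients. -/
theorem exists_symbolSum_eq (hreg : RingTheory.Sequence.IsWeaklyRegular R (List.ofFn h))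
    (hne : seqIdeal h ≠ ⊤) {y : (residueIdeal h M).Gr}
    (hy : ∀ a ∈ 𝔪, a • y = 0)
    (hy' : ∀ j, grVar (fun j => Ideal.Quotient.mk (monomialIdeal h M) (h j)) j * y = 0) :
    ∃ c : monoidSocle (monoidIdeal M) →₀ R ⧸ seqIdeal h,
      (∀ m, ∀ a ∈ 𝔪, a • c m = 0) ∧ symbolSum h M c = y := by
  classical
  obtain ⟨c, rfl⟩ := grEval_surjective h M y
  have h1 : ∀ a ∈ 𝔪, ∀ n ∉ monoidIdeal M, a * c n ∈ seqIdeal h := fun a ha n hn => by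
    have := hy a ha
    rw [← map_smul] at this
    exact mem_seqIdeal_of_grEval_eq_zero M hreg this hn
  have h2 : ∀ n ∉ monoidIdeal M, n ∉ monoidSocle (monoidIdeal M) → c n ∈ seqIdeal h := by
    intro n hn hs
    obtain ⟨j, hj⟩ := exists_add_single_notMem hn hs
    have h0 := hy' j
    rw [grVar_mul_grEval] at h0
    have := mem_seqIdeal_of_grEval_eq_zero M hreg h0 hj
    rwa [Finsupp.mapDomain_apply (add_left_injective (Pi.single j 1 : Fin t → ℕ))] at this
  set p : (Fin t → ℕ) → Prop := fun n => n ∈ monoidSocle (monoidIdeal M) with hp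
  set L : monoidSocle (monoidIdeal M) →₀ R :=
    c.comapDomain Subtype.val Subtype.val_injective.injOn with hL
  refine ⟨L.mapRange (Ideal.Quotient.mk (seqIdeal h)) (map_zero _), fun m a ha => ?_, ?_⟩
  · have : a • Ideal.Quotient.mk (seqIdeal h) (c m) = Ideal.Quotient.mk (seqIdeal h) (a * c m) :=
      rfl
    rw [Finsupp.mapRange_apply, hL, Finsupp.comapDomain_apply, this,
      Ideal.Quotient.eq_zero_iff_mem]
    exact h1 a ha m m.2.1
  · have hLc : L.mapDomain Subtype.val = c.filter p := by
      ext n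
      by_cases hn : p n
      · rw [Finsupp.filter_apply_pos p c hn]
        have := Finsupp.mapDomain_apply (Subtype.val_injective
          (p := fun n => n ∈ monoidSocle (monoidIdeal M))) L ⟨n, hn⟩
        rw [this, hL, Finsupp.comapDomain_apply]
      · rw [Finsupp.filter_apply_neg p c hn, Finsupp.mapDomain_of_notMem_range]
        rintro ⟨m, rfl⟩
        exact hn m.2
    rw [symbolSum_mapRange M hreg hne, hLc, eq_comm]
    conv_lhs => rw [← Finsupp.filter_add_filter_not c p, map_add]
    rw [add_eq_left, grEval, Finsupp.linearCombination_apply]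
    refine Finset.sum_eq_zero fun n hn => ?_
    rw [Finsupp.support_filter, Finset.mem_filter] at hn
    dsimp only
    by_cases hnM : n ∈ monoidIdeal M
    · rw [grMonomial_eq_zero h hnM, smul_zero]
    · rw [Finsupp.filter_apply_pos (fun n => ¬ p n) c hn.2]
      refine smul_gr_eq_zero _ ?_ _
      rw [residueIdeal_eq_map]
      exact Ideal.mem_map_of_mem _ (h2 n hnM hn.2)

theorem smul_symbolSum_eq_zero {c : monoidSocle (monoidIdeal M) →₀ R ⧸ seqIdeal h} {a : R}
    (hc : ∀ m, a • c m = 0) : a • symbolSum h M c = 0 ∧ a • socSum h M c = 0 := by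
  have : a • c = 0 := Finsupp.ext hc
  rw [← map_smul, ← map_smul, this, map_zero, map_zero]
  exact ⟨rfl, rfl⟩

theorem grVar_mul_symbolSum (hreg : RingTheory.Sequence.IsWeaklyRegular R (List.ofFn h))
    (hne : seqIdeal h ≠ ⊤) (j : Fin t) (c : monoidSocle (monoidIdeal M) →₀ R ⧸ seqIdeal h) :
    grVar (fun j => Ideal.Quotient.mk (monomialIdeal h M) (h j)) j * symbolSum h M c = 0 := by
  induction c using Finsupp.induction_linear with
  | zero => rw [map_zero, mul_zero]
  | add c d hc hd => rw [map_add, mul_add, hc, hd, add_zero]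
  | single m r =>
    obtain ⟨r, rfl⟩ := Ideal.Quotient.mk_surjective r
    rw [symbolSum, Finsupp.lsum_single, symbolMonomial_mk M hreg hne, mul_smul_comm,
      grVar_mul_grMonomial, grMonomial_eq_zero h (m.2.2 _ (by simp)), smul_zero]

/-- An element of the socle of the monomial quotient agrees with a combination of socle monomials
up to terms of higher order. -/
theorem exists_sub_socSum_mem (hreg : RingTheory.Sequence.IsWeaklyRegular R (List.ofFn h))
    (hne : seqIdeal h ≠ ⊤) (hle : seqIdeal h ≤ 𝔪) {x : R ⧸ monomialIdeal h M}
    (hx : ∀ a ∈ 𝔪, a • x = 0) {l : ℕ} (hxl : x ∈ residueIdeal h M ^ l) :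
    ∃ c : monoidSocle (monoidIdeal M) →₀ R ⧸ seqIdeal h,
      (∀ m, ∀ a ∈ 𝔪, a • c m = 0) ∧ (∀ m, c m ≠ 0 → ∑ j, m.1 j = l) ∧
      symbolSum h M c = grTerm _ l x hxl ∧
      x - socSum h M c ∈ residueIdeal h M ^ (l + 1) := by
  obtain ⟨c, hc, hcy⟩ := exists_symbolSum_eq (𝔪 := 𝔪) M hreg hne (y := grTerm _ l x hxl)
    (fun a ha => by
      rw [smul_grTerm, grTerm_eq_zero_iff, hx a ha]
      exact zero_mem _)
    (fun j => by
      have : Ideal.Quotient.mk (monomialIdeal h M) (h j) * x = 0 :=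
        hx _ (hle (Ideal.subset_span ⟨j, rfl⟩))
      rw [grVar, grTerm_mul, grTerm_eq_zero_iff, this]
      exact zero_mem _)
  have hcl : ∀ m, (c.filter fun m => ∑ j, m.1 j = l) m ≠ 0 → ∑ j, m.1 j = l := fun m hm => by
    by_contra hml
    exact hm (Finsupp.filter_apply_neg _ c hml)
  -- `β` respects degrees, so only the degree `l` terms contribute to a class of degree `l`.
  have hs : symbolSum h M (c.filter fun m => ∑ j, m.1 j = l) = grTerm _ l x hxl := by
    rw [← grComponent_symbolSum M hreg hne, hcy]
    exact grComponent_grOf_self _ _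
  refine ⟨c.filter fun m => ∑ j, m.1 j = l, fun m a ha => ?_, hcl, hs, ?_⟩
  · rw [Finsupp.filter_apply]
    split_ifs
    · exact hc m a ha
    · exact smul_zero _
  · obtain ⟨hx', h'⟩ := symbolSum_eq_grTerm M hreg hne hcl
    rw [← grTerm_eq_iff (hx := hxl) (hy := hx'), ← h', hs]

/-- The socle of the monomial quotient consists of combinations of socle monomials. -/
theorem exists_socSum_eq (hreg : RingTheory.Sequence.IsWeaklyRegular R (List.ofFn h))
    (hne : seqIdeal h ≠ ⊤) (hle : seqIdeal h ≤ 𝔪)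
    (hbot : (⨅ k : ℕ, residueIdeal h M ^ k) = ⊥) {x : R ⧸ monomialIdeal h M}
    (hx : ∀ a ∈ 𝔪, a • x = 0) :
    ∃ c : monoidSocle (monoidIdeal M) →₀ R ⧸ seqIdeal h,
      (∀ m, ∀ a ∈ 𝔪, a • c m = 0) ∧ socSum h M c = x := by
  have key : ∀ k, ∃ c : monoidSocle (monoidIdeal M) →₀ R ⧸ seqIdeal h,
      (∀ m, ∀ a ∈ 𝔪, a • c m = 0) ∧ x - socSum h M c ∈ residueIdeal h M ^ k := by
    intro k
    induction k with
    | zero => exact ⟨0, by simp, by simp⟩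
    | succ k ih =>
      obtain ⟨c, hc, hck⟩ := ih
      obtain ⟨e, he, -, -, hek⟩ := exists_sub_socSum_mem M hreg hne hle
        (x := x - socSum h M c) (fun a ha => by
          rw [smul_sub, hx a ha, (smul_symbolSum_eq_zero M fun m => hc m a ha).2, sub_zero]) hck
      refine ⟨c + e, fun m a ha => ?_, ?_⟩
      · rw [Finsupp.add_apply, smul_add, hc m a ha, he m a ha, add_zero]
      · rwa [map_add, ← sub_sub]
  -- `B` bounds the degrees in the socle of `𝕄`. From order `B + 1` on, every further correction is
  -- zero.
  obtain ⟨B, hB⟩ := ((monoidSocle_finite (monoidIdeal M)).image fun m => ∑ j, m j).bddAbove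
  obtain ⟨c, hc, hcB⟩ := key (B + 1)
  refine ⟨c, hc, ?_⟩
  have hz : ∀ a ∈ 𝔪, a • (x - socSum h M c) = 0 := fun a ha => by
    rw [smul_sub, hx a ha, (smul_symbolSum_eq_zero M fun m => hc m a ha).2, sub_zero]
  have hall : ∀ k, x - socSum h M c ∈ residueIdeal h M ^ (B + 1 + k) := by
    intro k
    induction k with
    | zero => exact hcB
    | succ k ih =>
      obtain ⟨e, -, hel, -, hek⟩ := exists_sub_socSum_mem M hreg hne hle hz ih
      have he0 : e = 0 := by
        ext m
        by_contra hem
        have h1 := hel m hem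
        have h2 : ∑ j, m.1 j ≤ B := hB ⟨m.1, m.2, rfl⟩
        omega
      rwa [he0, map_zero, sub_zero] at hek
  have : x - socSum h M c ∈ (⨅ k : ℕ, residueIdeal h M ^ k) :=
    (Ideal.mem_iInf).2 fun k => Ideal.pow_le_pow_right (by omega) (hall k)
  rw [hbot, Ideal.mem_bot, sub_eq_zero] at this
  exact this.symm

end Socle

/-! ### Properness and homogeneity of the ideals, and the main theorem -/

theorem IsStarLocalWith.seqIdeal_le {R : Type*} [CommRing R] {𝒜 : ℤ → AddSubgroup R}
    {𝔪 : Ideal R} (H : IsStarLocalWith 𝒜 𝔪) {t : ℕ} {h : Fin t → R}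
    (hhom : ∀ j, SetLike.IsHomogeneousElem 𝒜 (h j)) (hne : seqIdeal h ≠ ⊤) : seqIdeal h ≤ 𝔪 := by
  refine Ideal.span_le.2 ?_
  rintro _ ⟨j, rfl⟩
  by_contra hj
  obtain ⟨i, hi⟩ := hhom j
  exact hne (Ideal.eq_top_of_isUnit_mem _ (Ideal.subset_span ⟨j, rfl⟩) (H.isUnit i _ hi hj))

theorem monomialIdeal_le_seqIdeal {R : Type*} [CommRing R] {t u : ℕ} (h : Fin t → R)
    {M : Matrix (Fin u) (Fin t) ℕ} (hM : ∀ i, M i ≠ 0) : monomialIdeal h M ≤ seqIdeal h := by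
  refine Ideal.span_le.2 ?_
  rintro _ ⟨i, rfl⟩
  have hpos : 1 ≤ ∑ j, M i j := by
    by_contra hlt
    exact hM i (funext fun j => Finset.sum_eq_zero_iff.1 (by omega) j (Finset.mem_univ j))
  simpa using Ideal.pow_le_pow_right hpos (monomialPow_mem_seqIdeal_pow h (M i))

theorem seqIdeal_ne_top {R : Type*} [CommRing R] {t : ℕ} {h : Fin t → R}
    (hreg : RingTheory.Sequence.IsRegular R (List.ofFn h)) : seqIdeal h ≠ ⊤ := by
  intro htop
  refine hreg.top_ne_smul ?_
  have : Ideal.ofList (List.ofFn h) = seqIdeal h := by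
    rw [Ideal.ofList, seqIdeal]
    congr 1
    ext x
    simp [List.mem_ofFn]
  rw [this, htop, smul_eq_mul, Ideal.top_mul]

theorem isHomogeneous_monomialIdeal {R : Type*} [CommRing R] (𝒜 : ℤ → AddSubgroup R)
    [GradedRing 𝒜] {t u : ℕ} {h : Fin t → R} (hhom : ∀ j, SetLike.IsHomogeneousElem 𝒜 (h j))
    (M : Matrix (Fin u) (Fin t) ℕ) : (monomialIdeal h M).IsHomogeneous 𝒜 := by
  refine Ideal.homogeneous_span 𝒜 _ ?_
  rintro _ ⟨i, rfl⟩
  exact (SetLike.homogeneousSubmonoid 𝒜).prod_mem fun j _ =>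
    (SetLike.homogeneousSubmonoid 𝒜).pow_mem (hhom j) _

end

theorem corollary14 {R : Type*} [CommRing R] [IsNoetherianRing R]
    (𝒜 : ℤ → AddSubgroup R) [GradedRing 𝒜] (hR : IsStarLocal 𝒜)
    {t u : ℕ} (h : Fin t → R) (hhom : ∀ j, SetLike.IsHomogeneousElem 𝒜 (h j))
    (hreg : RingTheory.Sequence.IsRegular R (List.ofFn h))
    (M : Matrix (Fin u) (Fin t) ℕ) (hM : ∀ i, M i ≠ 0) :
    -- the three (bi)graded rings have unique (bi)graded maximal ideals
    IsStarLocal (quotientGrading 𝒜 (seqIdeal h)) ∧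
    IsStarLocal (quotientGrading 𝒜 (monomialIdeal h M)) ∧
    IsStarLocal ((residueIdeal h M).grBigrading (quotientGrading 𝒜 (monomialIdeal h M))) ∧
    -- the symbol map is defined outside zero
    (⨅ k : ℕ, residueIdeal h M ^ k) = ⊥ ∧
    -- the socle of the monomial quotient
    Function.Injective (socSum h M) ∧
    socSum h M '' {c | ∀ m, c m ∈ starSocle (quotientGrading 𝒜 (seqIdeal h))} =
      starSocle (quotientGrading 𝒜 (monomialIdeal h M)) ∧
    -- the socle of the associated graded ring
    Function.Injective (symbolSum h M) ∧
    symbolSum h M '' {c | ∀ m, c m ∈ starSocle (quotientGrading 𝒜 (seqIdeal h))} =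
      starSocle ((residueIdeal h M).grBigrading (quotientGrading 𝒜 (monomialIdeal h M))) ∧
    -- the symbol of an element of the direct sum is given by its terms of lowest degree
    (∀ (d : ℕ) (c : monoidSocle (monoidIdeal M) →₀ R ⧸ seqIdeal h),
      (∀ m, ∑ j, m.1 j < d → c m = 0) →
      c.filter (fun m => ∑ j, m.1 j = d) ≠ 0 →
      (residueIdeal h M).symbol (socSum h M c) =
        symbolSum h M (c.filter fun m => ∑ j, m.1 j = d)) ∧
    -- the symbol map sends the socle onto the set of homogeneous elements of the socle
    (residueIdeal h M).symbol '' (starSocle (quotientGrading 𝒜 (monomialIdeal h M))) =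
      {y | y ∈ starSocle
          ((residueIdeal h M).grBigrading (quotientGrading 𝒜 (monomialIdeal h M))) ∧
        ∃ l, y ∈ Set.range ((residueIdeal h M).grOf l)} ∧
    -- the resulting isomorphism of socles, which is the symbol map on the summands of each degree
    ∃ Φ : starSocle (quotientGrading 𝒜 (monomialIdeal h M)) ≃ₗ[R]
        starSocle ((residueIdeal h M).grBigrading (quotientGrading 𝒜 (monomialIdeal h M))),
      (∀ x c, x.1 = socSum h M c → (Φ x).1 = symbolSum h M c) ∧
      ∀ (d : ℕ) (x : starSocle (quotientGrading 𝒜 (monomialIdeal h M)))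
        (c : monoidSocle (monoidIdeal M) →₀ R ⧸ seqIdeal h), x.1 = socSum h M c →
        (∀ m, c m ≠ 0 → ∑ j, m.1 j = d) →
        (Φ x).1 = (residueIdeal h M).symbol x.1 := by
  obtain ⟨𝔪, H⟩ := hR.exists_isStarLocalWith
  have hw := hreg.toIsWeaklyRegular
  have hne := seqIdeal_ne_top hreg
  have hle := H.seqIdeal_le hhom hne
  -- Nonzero rows keep the monomial ideal proper.
  have hQ : monomialIdeal h M ≤ 𝔪 := (monomialIdeal_le_seqIdeal h hM).trans hle
  obtain ⟨HG, hG⟩ := mem_starSocle_gr_iff h M H hhom hle hQ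
  have hI : (seqIdeal h).IsHomogeneous 𝒜 := Ideal.homogeneous_span 𝒜 _ (by
    rintro _ ⟨j, rfl⟩
    exact hhom j)
  have hbot : (⨅ k : ℕ, residueIdeal h M ^ k) = ⊥ := by
    rw [residueIdeal_eq_map]
    exact H.iInf_map_pow_eq_bot hI (isHomogeneous_monomialIdeal 𝒜 hhom M) hle
  have hC : ∀ c : monoidSocle (monoidIdeal M) →₀ R ⧸ seqIdeal h,
      (∀ m, c m ∈ starSocle (quotientGrading 𝒜 (seqIdeal h))) ↔ ∀ m, ∀ a ∈ 𝔪, a • c m = 0 :=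
    fun c => forall_congr' fun m => H.mem_starSocle_quotient_iff hle
  have hA : ∀ x, x ∈ starSocle (quotientGrading 𝒜 (monomialIdeal h M)) ↔ ∀ a ∈ 𝔪, a • x = 0 :=
    fun x => H.mem_starSocle_quotient_iff hQ
  have hαmem : ∀ c : monoidSocle (monoidIdeal M) →₀ R ⧸ seqIdeal h,
      (∀ m, c m ∈ starSocle (quotientGrading 𝒜 (seqIdeal h))) →
      socSum h M c ∈ starSocle (quotientGrading 𝒜 (monomialIdeal h M)) := fun c hc =>
    (hA _).2 fun a ha => (smul_symbolSum_eq_zero M fun m => (hC c).1 hc m a ha).2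
  have hβmem : ∀ c : monoidSocle (monoidIdeal M) →₀ R ⧸ seqIdeal h,
      (∀ m, c m ∈ starSocle (quotientGrading 𝒜 (seqIdeal h))) →
      symbolSum h M c ∈ starSocle
        ((residueIdeal h M).grBigrading (quotientGrading 𝒜 (monomialIdeal h M))) := fun c hc =>
    (hG _).2 ⟨fun a ha => (smul_symbolSum_eq_zero M fun m => (hC c).1 hc m a ha).1,
      fun j => grVar_mul_symbolSum M hw hne j c⟩
  have hαsurj : ∀ x ∈ starSocle (quotientGrading 𝒜 (monomialIdeal h M)),
      ∃ c : monoidSocle (monoidIdeal M) →₀ R ⧸ seqIdeal h,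
        (∀ m, c m ∈ starSocle (quotientGrading 𝒜 (seqIdeal h))) ∧ socSum h M c = x := by
    intro x hx
    obtain ⟨c, hc, hcx⟩ := exists_socSum_eq M hw hne hle hbot ((hA x).1 hx)
    exact ⟨c, (hC c).2 hc, hcx⟩
  have hβsurj : ∀ y ∈ starSocle
        ((residueIdeal h M).grBigrading (quotientGrading 𝒜 (monomialIdeal h M))),
      ∃ c : monoidSocle (monoidIdeal M) →₀ R ⧸ seqIdeal h,
        (∀ m, c m ∈ starSocle (quotientGrading 𝒜 (seqIdeal h))) ∧ symbolSum h M c = y := by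
    intro y hy
    obtain ⟨c, hc, hcy⟩ := exists_symbolSum_eq M hw hne ((hG y).1 hy).1 ((hG y).1 hy).2
    exact ⟨c, (hC c).2 hc, hcy⟩
  have hαinj := socSum_injective M hw hne
  have hβinj := symbolSum_injective M hw hne
  have hfilter : ∀ (d : ℕ) (c : monoidSocle (monoidIdeal M) →₀ R ⧸ seqIdeal h),
      (∀ m, c m ≠ 0 → ∑ j, m.1 j = d) → c.filter (fun m => ∑ j, m.1 j = d) = c := by
    intro d c hc
    ext m
    rw [Finsupp.filter_apply]
    split_ifs with hm
    · rfl
    · by_contra h0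
      exact hm (hc m (Ne.symm h0))
  have hsymb : ∀ (d : ℕ) (c : monoidSocle (monoidIdeal M) →₀ R ⧸ seqIdeal h),
      (∀ m, c m ≠ 0 → ∑ j, m.1 j = d) →
      (residueIdeal h M).symbol (socSum h M c) = symbolSum h M c := by
    intro d c hc
    rcases eq_or_ne c 0 with rfl | hc0
    · rw [map_zero, map_zero, Ideal.symbol_zero]
    · have := (symbol_socSum M hw hne (d := d) (c := c) (fun m hm => by
        by_contra h0
        exact absurd (hc m h0) hm.ne) (by rwa [hfilter d c hc])).2
      rwa [hfilter d c hc] at this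
  refine ⟨(H.quotient hle).isStarLocal, (H.quotient hQ).isStarLocal, HG.isStarLocal, hbot, hαinj,
    ?_, hβinj, ?_, fun d c hc hcd => (symbol_socSum M hw hne hc hcd).2, ?_, ?_⟩
  · ext x
    constructor
    · rintro ⟨c, hc, rfl⟩
      exact hαmem c hc
    · exact fun hx => hαsurj x hx
  · ext y
    constructor
    · rintro ⟨c, hc, rfl⟩
      exact hβmem c hc
    · exact fun hy => hβsurj y hy
  · ext y
    constructor
    · rintro ⟨x, hx, rfl⟩
      by_cases hex : ∃ k, x ∉ residueIdeal h M ^ k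
      · obtain ⟨l, hl, -, hs⟩ := Ideal.exists_symbol_eq x hex
        -- The symbol is the class of `x` in degree `l`, which is `β` of a combination with socle
        -- coefficients.
        obtain ⟨c, hc, -, hcy, -⟩ := exists_sub_socSum_mem M hw hne hle ((hA x).1 hx) hl
        rw [hs]
        refine ⟨?_, l, ⟨_, rfl⟩⟩
        rw [← hcy]
        exact hβmem c ((hC c).2 hc)
      · push Not at hex
        rw [Ideal.symbol_eq_zero hex]
        exact ⟨zero_mem _, 0, 0, map_zero _⟩
    · rintro ⟨hy, l, z, rfl⟩
      obtain ⟨c, hc, hcy⟩ := hβsurj _ hy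
      -- Since `β` respects degrees and is injective, a preimage of an element of degree `l` is
      -- concentrated in degree `l`; its image under `α` then has the required symbol.
      have hcl : c.filter (fun m => ∑ j, m.1 j = l) = c := hβinj (by
        rw [← grComponent_symbolSum M hw hne, hcy, Ideal.grComponent_grOf_self])
      refine ⟨socSum h M c, hαmem c hc, ?_⟩
      rw [hsymb l c, hcy]
      intro m hm
      by_contra hml
      rw [← hcl] at hm
      exact hm (Finsupp.filter_apply_neg _ c hml)
  · let C : Submodule R (monoidSocle (monoidIdeal M) →₀ R ⧸ seqIdeal h) :=
      { carrier := {c | ∀ m, c m ∈ starSocle (quotientGrading 𝒜 (seqIdeal h))}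
        add_mem' := fun ha hb m => add_mem (ha m) (hb m)
        zero_mem' := fun m => zero_mem _
        smul_mem' := fun r c hc m => Submodule.smul_of_tower_mem _ r (hc m) }
    let α : C →ₗ[R] starSocle (quotientGrading 𝒜 (monomialIdeal h M)) :=
      { toFun := fun c => ⟨socSum h M c.1, hαmem c.1 c.2⟩
        map_add' := fun a b => Subtype.ext (map_add _ _ _)
        map_smul' := fun r a => Subtype.ext (map_smul _ _ _) }
    let β : C →ₗ[R] starSocle
        ((residueIdeal h M).grBigrading (quotientGrading 𝒜 (monomialIdeal h M))) :=
      { toFun := fun c => ⟨symbolSum h M c.1, hβmem c.1 c.2⟩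
        map_add' := fun a b => Subtype.ext (map_add _ _ _)
        map_smul' := fun r a => Subtype.ext (map_smul _ _ _) }
    have hα : Function.Bijective α :=
      ⟨fun a b hab => Subtype.ext (hαinj (congrArg Subtype.val hab)), fun x => by
        obtain ⟨c, hc, hcx⟩ := hαsurj x.1 x.2
        exact ⟨⟨c, hc⟩, Subtype.ext hcx⟩⟩
    have hβ : Function.Bijective β :=
      ⟨fun a b hab => Subtype.ext (hβinj (congrArg Subtype.val hab)), fun y => by
        obtain ⟨c, hc, hcy⟩ := hβsurj y.1 y.2
        exact ⟨⟨c, hc⟩, Subtype.ext hcy⟩⟩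
    -- The isomorphism is `β` after the inverse of `α`, both restricted to families with socle
    -- coefficients.
    let Φ := (LinearEquiv.ofBijective α hα).symm.trans (LinearEquiv.ofBijective β hβ)
    have hΦ : ∀ x c, x.1 = socSum h M c → (Φ x).1 = symbolSum h M c := by
      intro x c hxc
      obtain ⟨e, rfl⟩ := hα.2 x
      -- Injectivity of `α` on all families, not only those in `C`, identifies an arbitrary
      -- representation of `x` with the one in `C`.
      have he : e.1 = c := hαinj hxc
      have : Φ (α e) = β e :=
        congrArg β ((LinearEquiv.ofBijective α hα).symm_apply_apply e)
      rw [this, ← he]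
      rfl
    refine ⟨Φ, hΦ, fun d x c hxc hc => ?_⟩
    rw [hΦ x c hxc, hxc, hsymb d c hc]
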